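/- Setting. Let $K$ be a complex Hilbert space (of the full theory; massive excitations are allowed), with a dense subspace $D$. On ${\cal I}^+=\mathbb R\times S^2\ni(u,\Omega)$ let the asymptotic fields, namely the Bondi mass aspect $m_{\rm B}(u,\Omega)$, the symmetric trace-free shear $C_{AB}(u,\Omega)$ and massless matter fields $O(u,\Omega)$, be hermitian operator-valued distributions on ${\cal I}^+$ with common invariant domain $D$. Every field smeared with a real test function is assumed essentially self-adjoint on $D$. Let $M(u)=\int m_{\rm B}(u,\Omega)\,d\Omega$ be the Bondi mass. For each $g\in C_c^\infty(\mathbb R,\mathbb R)$ let the unitary group $U_g(s)=e^{is\overline{M(g)}}$ generated by $M(g)=\int g(u)M(u)\,du$ preserve $D$, and for all $\psi\in D$ and every field $\Phi$ let $f\mapsto\Phi(f)U_g(s)\psi$ be a $K$-valued distribution, with order and bounds uniform for $s$ in compact sets. For $u_1<u_2$, the segment algebra ${\cal B}_{u_1,u_2}$ is the von Neumann algebra generated by the bounded functions of all the fields smeared with test functions supported at $u\in(u_1,u_2)$, and ${\cal A}_{u_1,\epsilon}={\cal B}_{u_1,u_1+\epsilon}$ is the algebra of the $\epsilon$-neighbourhood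 of the cut $u_1$. Assume that, with $G>0$ Newton's constant: (i) for $\Phi\in\{C_{AB},O\}$, $[M(u),\Phi(u',\Omega)]=-4\pi G\,i\,\partial_{u'}\Phi(u',\Omega)\,\theta(u'-u)$ up to local operators at $u$; that is, for all $g\in C_c^\infty(\mathbb R,\mathbb R)$ and all real test functions $f$, the operator $[M(g),\Phi(f)]-4\pi G\,i\,\Phi\big(\partial_u(\hat g f)\big)$, where $\hat g(u)=\int_{-\infty}^u g$, is affiliated with ${\cal B}_{v,w}$ whenever $\operatorname{supp} g\subset(v,w)$; (ii) $\partial_u m_{\rm B}=\tfrac14\partial_uD^AD^BC_{AB}-F$, where the flux $F$ (classically $\tfrac18N_{AB}N^{AB}+4\pi G\,T^{{\rm M}(0)}_{uu}$ with $N_{AB}=\partial_uC_{AB}$) is, up to and including any corrections, a local operator of the radiative fields: smeared with a test function supported at $u\in(v,w)$, it is affiliated with the von Neumann algebra generated by $C_{AB}$ and $O$ in $(v,w)$. Let $\mu$ be a density matrix on $K$, and let $\operatorname{Tr}$ be either the trace on $K$ or any faithful normal trace on ${\cal B}_{u_1,u_2}$. A reduced density matrix of $\mu$ on the segment $(u_1,u_2)$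 is a positive operator $\rho_{u_1,u_2}\in{\cal B}_{u_1,u_2}$ with $\operatorname{Tr}(\rho_{u_1,u_2}b)=\operatorname{Tr}_K(\mu b)$ for all positive (hence all) $b\in{\cal B}_{u_1,u_2}$, and the fine-grained von Neumann entropy of the segment is $S_{u_1,u_2}=-\operatorname{Tr}(\rho_{u_1,u_2}\log\rho_{u_1,u_2})$. Claim. $S_{u_1,u_2}$ is independent of $u_2$, for every state $\mu$. Precisely, for all $u_1<u_2$ and $u_1<u_2'$: ${\cal B}_{u_1,u_2}\subseteq{\cal A}_{u_1,\epsilon}$ for every $\epsilon>0$; an operator $\rho$ is a reduced density matrix of $\mu$ on $(u_1,u_2)$ if and only if it is one on $(u_1,u_2')$ (so that it can be chosen in every ${\cal A}_{u_1,\epsilon}$); and the von Neumann entropies of any reduced density matrices of $\mu$ on $(u_1,u_2)$ and on $(u_1,u_2')$ are equal. -/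

import Mathlib

open scoped ContDiff InnerProductSpace ENNReal NNReal

noncomputable section

namespace NullInfinity

/-! ### Test functions on future null infinity

Future null infinity is `ℝ × S²`, with `S²` the unit sphere of `ℝ³`. A smooth function on `ℝ × S²`
is represented by any smooth extension to `ℝ × ℝ³`; the fields below only see its restriction to
`ℝ × S²`. -/

/-- Three-dimensional Euclidean space, in which the celestial sphere is the unit sphere. -/
abbrev E3 : Type := EuclideanSpace ℝ (Fin 3)

/-- Smooth real functions of `(u, x) ∈ ℝ × ℝ³` that vanish for large `|u|`. -/
def TestFn : Submodule ℝ (ℝ × E3 → ℝ) where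
  carrier := {f | ContDiff ℝ ∞ f ∧ ∃ R : ℝ, ∀ p : ℝ × E3, R < |p.1| → f p = 0}
  zero_mem' := ⟨contDiff_const, 0, fun _ _ => rfl⟩
  add_mem' := by
    rintro f g ⟨hf, R, hR⟩ ⟨hg, S, hS⟩
    refine ⟨hf.add hg, max R S, fun p hp => ?_⟩
    simp [hR p (lt_of_le_of_lt (le_max_left _ _) hp), hS p (lt_of_le_of_lt (le_max_right _ _) hp)]
  smul_mem' := by
    rintro c f ⟨hf, R, hR⟩
    refine ⟨contDiff_const.smul hf, R, fun p hp => ?_⟩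
    simp [hR p hp]

/-- The directional derivative of a test function along a fixed vector of `ℝ × ℝ³`. -/
def TestFn.dir (v : ℝ × E3) (f : TestFn) : TestFn :=
  ⟨fun p => fderiv ℝ f.1 p v, by
    obtain ⟨hf, R, hR⟩ := f.2
    refine ⟨(hf.fderiv_right (m := ∞) (by simp)).clm_apply contDiff_const, R, fun p hp => ?_⟩
    have hopen : IsOpen {q : ℝ × E3 | R < |q.1|} :=
      isOpen_lt continuous_const (continuous_abs.comp continuous_fst)
    have hev : f.1 =ᶠ[nhds p] fun _ => (0 : ℝ) := by
      filter_upwards [hopen.mem_nhds hp] with q hq using hR q hq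
    simp [hev.fderiv_eq]⟩

/-- The derivative along null infinity, `∂_u f`. -/
def TestFn.du (f : TestFn) : TestFn := TestFn.dir (1, 0) f

/-- The Cartesian derivative `∂_i f` along the `i`-th axis of `ℝ³`. -/
def TestFn.dx (i : Fin 3) (f : TestFn) : TestFn := TestFn.dir (0, EuclideanSpace.single i 1) f

/-- The product of a test function with a smooth function. -/
def TestFn.mulSmooth (a : ℝ × E3 → ℝ) (ha : ContDiff ℝ ∞ a) (f : TestFn) : TestFn :=
  ⟨fun p => a p * f.1 p, by
    obtain ⟨hf, R, hR⟩ := f.2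
    exact ⟨ha.mul hf, R, fun p hp => by simp [hR p hp]⟩⟩

/-- The product `x_i f` of a test function with the `i`-th Cartesian coordinate. -/
def TestFn.mulCoord (i : Fin 3) (f : TestFn) : TestFn :=
  TestFn.mulSmooth (fun p => p.2 i) (by fun_prop) f

/-- The (compact) closure of the set of all `u` with `f (u, x) ≠ 0` for some `x` lies in `I`. -/
def TestFn.SupportedIn (f : TestFn) (I : Set ℝ) : Prop :=
  closure (Prod.fst '' Function.support f.1) ⊆ I

/-- Smooth compactly supported functions of retarded time alone. -/
structure TimeFn where
  toFun : ℝ → ℝ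
  smooth : ContDiff ℝ ∞ toFun
  compact : HasCompactSupport toFun

/-- A function of retarded time, as a test function constant over the celestial sphere. -/
def TimeFn.toTestFn (g : TimeFn) : TestFn :=
  ⟨fun p => g.toFun p.1, by
    refine ⟨g.smooth.comp contDiff_fst, ?_⟩
    obtain ⟨R, hR⟩ := g.compact.isCompact.isBounded.subset_closedBall 0
    refine ⟨R, fun p hp => ?_⟩
    by_contra hne
    have h := hR (subset_tsupport _ (Function.mem_support.mpr hne))
    rw [Metric.mem_closedBall, dist_zero_right, Real.norm_eq_abs] at h
    exact absurd h (not_le.mpr hp)⟩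

/-- The primitive `u ↦ ∫_{-∞}^u g`, that is `∫ g(t) θ(u - t) dt`. -/
def TimeFn.primitive (g : TimeFn) (u : ℝ) : ℝ := ∫ t in Set.Iic u, g.toFun t

theorem TimeFn.hasDerivAt_primitive (g : TimeFn) (u : ℝ) :
    HasDerivAt g.primitive (g.toFun u) u := by
  have hc : Continuous g.toFun := g.smooth.continuous
  have hi : MeasureTheory.Integrable g.toFun := hc.integrable_of_hasCompactSupport g.compact
  have h1 : g.primitive = fun u => (∫ t in Set.Iic (0 : ℝ), g.toFun t) + ∫ t in (0 : ℝ)..u,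
      g.toFun t := by
    funext u
    rw [← intervalIntegral.integral_Iic_sub_Iic hi.integrableOn hi.integrableOn]
    simp [TimeFn.primitive]
  rw [h1]
  exact (intervalIntegral.integral_hasDerivAt_right (hc.intervalIntegrable _ _)
    (hc.stronglyMeasurableAtFilter _ _) hc.continuousAt).const_add _

theorem TimeFn.contDiff_primitive (g : TimeFn) : ContDiff ℝ ∞ g.primitive := by
  rw [contDiff_infty_iff_deriv]
  refine ⟨fun u => (g.hasDerivAt_primitive u).differentiableAt, ?_⟩
  have h : deriv g.primitive = g.toFun := funext fun u => (g.hasDerivAt_primitive u).deriv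
  rw [h]
  exact g.smooth

/-- The product of a test function `f(u, x)` with the primitive `∫ g(t) θ(u - t) dt`. -/
def TestFn.mulPrimitive (g : TimeFn) (f : TestFn) : TestFn :=
  TestFn.mulSmooth (fun p => g.primitive p.1) (g.contDiff_primitive.comp contDiff_fst) f

/-! ### Operators on a common dense invariant domain -/

section Operators

variable {K : Type*} [NormedAddCommGroup K] [InnerProductSpace ℂ K]

/-- The closure in `K × K` of the graph of an operator on the domain `D`. -/
def closedGraph {D : Submodule ℂ K} (A : D →ₗ[ℂ] D) : Set (K × K) :=
  closure {p | ∃ χ : D, p = ((χ : K), (A χ : K))}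

/-- `A` is symmetric on `D`. -/
def IsSymmetricOn {D : Submodule ℂ K} (A : D →ₗ[ℂ] D) : Prop :=
  ∀ φ ψ : D, ⟪(A φ : K), (ψ : K)⟫_ℂ = ⟪(φ : K), (A ψ : K)⟫_ℂ

/-- `A` is essentially self-adjoint on the dense domain `D`: it is symmetric and the graph of its
adjoint is contained in the graph of its closure. -/
def IsEssSelfAdjointOn {D : Submodule ℂ K} (A : D →ₗ[ℂ] D) : Prop :=
  IsSymmetricOn A ∧
    ∀ η ζ : K, (∀ φ : D, ⟪(A φ : K), η⟫_ℂ = ⟪(φ : K), ζ⟫_ℂ) → (η, ζ) ∈ closedGraph A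

/-- The bounded operator `X` commutes with the closure of `A`: if `Ā` is the closure of `A`, then
`X Ā ⊆ Ā X`. -/
def CommutesWithClosure {D : Submodule ℂ K} (X : K →L[ℂ] K) (A : D →ₗ[ℂ] D) : Prop :=
  ∀ ψ : D, (X (ψ : K), X (A ψ : K)) ∈ closedGraph A

/-- `U` is a one-parameter group of unitaries which preserves `D` and whose generator extends
`A`, so that `U s = exp (i s Ā)`. -/
structure IsUnitaryFlow {D : Submodule ℂ K} (A : D →ₗ[ℂ] D) (U : ℝ → (K ≃ₗᵢ[ℂ] K)) : Prop where
  add : ∀ (s t : ℝ) (ψ : K), U (s + t) ψ = U s (U t ψ)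
  preserves : ∀ (s : ℝ) (ψ : D), U s (ψ : K) ∈ D
  generator : ∀ ψ : D, HasDerivAt (fun s : ℝ => U s (ψ : K)) (Complex.I • (A ψ : K)) 0

variable [CompleteSpace K]

/-- The von Neumann algebra whose elements commute with all of `S` and with all adjoints of
elements of `S`. -/
def commutantOf (S : Set (K →L[ℂ] K)) : VonNeumannAlgebra K where
  toStarSubalgebra := StarSubalgebra.centralizer ℂ S
  centralizer_centralizer' := by
    change Set.centralizer (Set.centralizer (StarSubalgebra.centralizer ℂ S : Set (K →L[ℂ] K)))
      = (StarSubalgebra.centralizer ℂ S : Set (K →L[ℂ] K))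
    rw [StarSubalgebra.coe_centralizer]
    exact Set.centralizer_centralizer_centralizer _

/-- The von Neumann algebra generated by all bounded functions of a family `F` of operators on
`D`: the commutant of the bounded operators that, together with their adjoints, commute with the
closures of all members of `F`. -/
def generatedAlgebra {D : Submodule ℂ K} (F : Set (D →ₗ[ℂ] D)) : VonNeumannAlgebra K :=
  commutantOf {X | ∀ A ∈ F, CommutesWithClosure X A ∧ CommutesWithClosure (star X) A}

/-- The operator `A` on `D` is affiliated with `N` (it is a possibly unbounded function of
operators in `N`): every bounded operator in the commutant of `N` commutes with the closure
of `A`. -/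
def Affiliated (N : VonNeumannAlgebra K) {D : Submodule ℂ K} (A : D →ₗ[ℂ] D) : Prop :=
  ∀ X ∈ N.commutant, CommutesWithClosure X A

end Operators

/-! ### Asymptotic fields -/

/-- The asymptotic fields: the Bondi mass aspect `m_B`, the Cartesian components
`C_ij = C_AB (D^A x_i) (D^B x_j)` of the shear, and the components of the massless matter fields,
labelled by `ι`. -/
inductive FieldIndex (ι : Type*) where
  | bondiMass : FieldIndex ι
  | shear (i j : Fin 3) : FieldIndex ι
  | matter (a : ι) : FieldIndex ι

/-- A system of asymptotic quantum fields on future null infinity: hermitian operator-valued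
distributions on a common dense invariant domain `domain` of the Hilbert space `K`. The Hilbert
space `K` is that of the full theory, so it may describe massive excitations as well.
`field a f` is the field `a` smeared with the real test function `f`. -/
structure AsymptoticFields (K : Type*) [NormedAddCommGroup K] [InnerProductSpace ℂ K]
    (ι : Type*) where
  domain : Submodule ℂ K
  dense : Dense (domain : Set K)
  field : FieldIndex ι → TestFn →+ (domain →ₗ[ℂ] domain)
  field_smul : ∀ a (r : ℝ) (f : TestFn), field a (r • f) = (r : ℂ) • field a f
  /-- A field only depends on the test function through its restriction to `ℝ × S²`. -/
  field_restrict : ∀ a (f : TestFn), (∀ (u : ℝ) (x : E3), ‖x‖ = 1 → f.1 (u, x) = 0) →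
    field a f = 0
  /-- Real smeared fields are observables, so functions of them and their spectral projections are
  defined. -/
  field_selfAdjoint : ∀ a f, IsEssSelfAdjointOn (field a f)
  shear_symm : ∀ i j f, field (.shear i j) f = field (.shear j i) f
  shear_traceless : ∀ f, ∑ i, field (.shear i i) f = 0
  /-- The shear is tangent to the celestial sphere: `∑ i, x_i C_ij = 0`. -/
  shear_tangent : ∀ j f, ∑ i, field (.shear i j) (TestFn.mulCoord i f) = 0
  /-- For every `g`, the unitary group generated by the Bondi mass `∫ g(u) M(u) du` preserves the
  domain, and the fields applied to an orbit of this group are vector-valued distributions, of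
  order and with bounds that are locally uniform along the orbit. -/
  regular : ∀ g : TimeFn, ∃ U : ℝ → (K ≃ₗᵢ[ℂ] K),
    ∃ hU : IsUnitaryFlow (field .bondiMass g.toTestFn) U,
      ∀ (a : FieldIndex ι) (ψ : domain) (R S : ℝ), ∃ (C : ℝ) (N : ℕ), ∀ f : TestFn,
        (∀ p : ℝ × E3, R < |p.1| → f.1 p = 0) → ∀ s : ℝ, |s| ≤ S → ∀ B : ℝ,
          (∀ k ≤ N, ∀ (u : ℝ) (x : E3), ‖x‖ = 1 → ‖iteratedFDeriv ℝ k f.1 (u, x)‖ ≤ B) →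
            ‖field a f ⟨U s ψ, hU.preserves s ψ⟩‖ ≤ C * B

namespace AsymptoticFields

variable {K : Type*} [NormedAddCommGroup K] [InnerProductSpace ℂ K] {ι : Type*}

/-- The Bondi mass `M(u) = ∫ m_B(u, Ω) dΩ`, smeared with the function `g` of retarded time. -/
def bondiMass (T : AsymptoticFields K ι) (g : TimeFn) : T.domain →ₗ[ℂ] T.domain :=
  T.field .bondiMass g.toTestFn

/-- The field `D^A D^B C_AB`, smeared with `f`; equivalently `C^AB` smeared with `D_A D_B f`. As
`C_ij` is tangent and trace free, `D_A D_B f` may be replaced by the Cartesian second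
derivatives. -/
def divDivShear (T : AsymptoticFields K ι) (f : TestFn) : T.domain →ₗ[ℂ] T.domain :=
  ∑ i, ∑ j, T.field (.shear i j) (TestFn.dx i (TestFn.dx j f))

variable [CompleteSpace K]

/-- The algebra of all bounded functions of the asymptotic fields with retarded time in
`(u₁, u₂)`. -/
def segmentAlgebra (T : AsymptoticFields K ι) (u₁ u₂ : ℝ) : VonNeumannAlgebra K :=
  generatedAlgebra {A | ∃ a f, TestFn.SupportedIn f (Set.Ioo u₁ u₂) ∧ A = T.field a f}

/-- The algebra of the `ε`-neighbourhood of the cut at `u`. -/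
def cutAlgebra (T : AsymptoticFields K ι) (u ε : ℝ) : VonNeumannAlgebra K :=
  T.segmentAlgebra u (u + ε)

/-- The algebra of all bounded functions of the radiative fields alone (shear and massless matter,
without the Bondi mass aspect) with retarded time in `(u₁, u₂)`. -/
def radiativeAlgebra (T : AsymptoticFields K ι) (u₁ u₂ : ℝ) : VonNeumannAlgebra K :=
  generatedAlgebra {A | ∃ a f, a ≠ .bondiMass ∧ TestFn.SupportedIn f (Set.Ioo u₁ u₂) ∧
    A = T.field a f}

/-- The commutators of the Bondi mass with the other asymptotic fields and its evolution equation
hold up to local operators, `G` being Newton's constant.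

* `commutator`: for every shear or matter field `φ`,
  `[M(u), φ(u')] = -4πG i ∂_{u'} φ(u') θ(u' - u)` up to operators in the algebra at `u`. Smeared
  with `g(u)` and `f(u')`, the right-hand side is `4πG i φ(∂_u (f ∫ g(t) θ(· - t) dt))`.
* `evolution`: `∂_u m_B = (1/4) ∂_u D^A D^B C_AB - F`, where the flux `F` is a local operator
  of the radiative fields. The classical flux is `(1/8) N_AB N^AB + 4πG T_uu`, with `N_AB` the news
  `∂_u C_AB` and `T_uu` the matter stress tensor; any definition of these products and any
  local corrections are allowed. -/
structure BondiMassLaws (T : AsymptoticFields K ι) (G : ℝ) : Prop where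
  commutator : ∀ a : FieldIndex ι, a ≠ .bondiMass → ∀ (g : TimeFn) (f : TestFn) (v w : ℝ),
    tsupport g.toFun ⊆ Set.Ioo v w →
      Affiliated (T.segmentAlgebra v w)
        (T.bondiMass g ∘ₗ T.field a f - T.field a f ∘ₗ T.bondiMass g
          - ((4 * Real.pi * G : ℝ) * Complex.I : ℂ) • T.field a (TestFn.du (TestFn.mulPrimitive g f)))
  evolution : ∀ (f : TestFn) (v w : ℝ), TestFn.SupportedIn f (Set.Ioo v w) →
    Affiliated (T.radiativeAlgebra v w)
      (T.field .bondiMass (TestFn.du f) - (1 / 4 : ℂ) • T.divDivShear (TestFn.du f))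

end AsymptoticFields

/-! ### Density matrices and von Neumann entropy -/

section Entropy

variable (K : Type*) [NormedAddCommGroup K] [InnerProductSpace ℂ K] [CompleteSpace K]

/-- The trace of a positive operator on the Hilbert space `K`, computed in an orthonormal basis
(the value does not depend on the basis). -/
def hilbertTrace (A : K →L[ℂ] K) : ℝ≥0∞ :=
  let b := (exists_hilbertBasis ℂ K).choose_spec.choose
  ∑' i, ENNReal.ofReal (⟪b i, A (b i)⟫_ℂ).re

variable {K}

/-- `μ` is a density matrix on `K`. -/
def IsDensityMatrix (μ : K →L[ℂ] K) : Prop := 0 ≤ μ ∧ hilbertTrace K μ = 1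

/-- `τ` is a faithful normal trace on the positive elements of `N`. -/
structure IsFaithfulNormalTrace (N : VonNeumannAlgebra K) (τ : (K →L[ℂ] K) → ℝ≥0∞) : Prop where
  add : ∀ A ∈ N, ∀ B ∈ N, 0 ≤ A → 0 ≤ B → τ (A + B) = τ A + τ B
  smul : ∀ (r : ℝ≥0), ∀ A ∈ N, 0 ≤ A → τ (((r : ℝ) : ℂ) • A) = r * τ A
  tracial : ∀ A ∈ N, τ (star A * A) = τ (A * star A)
  faithful : ∀ A ∈ N, 0 ≤ A → τ A = 0 → A = 0
  normal : ∀ (S : Set (K →L[ℂ] K)) (A : K →L[ℂ] K), S.Nonempty → (∀ B ∈ S, B ∈ N ∧ 0 ≤ B) →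
    DirectedOn (· ≤ ·) S → IsLUB S A → τ A = ⨆ B ∈ S, τ B

/-- `Tr (ρ B)` for positive `ρ` and `B`, where `Tr` is the trace `τ`; written as
`Tr (ρ^{1/2} B ρ^{1/2})`, whose argument is positive. -/
def pairing (τ : (K →L[ℂ] K) → ℝ≥0∞) (ρ B : K →L[ℂ] K) : ℝ≥0∞ :=
  τ (CFC.sqrt ρ * B * CFC.sqrt ρ)

/-- `ρ` is the reduced density matrix of the state `μ` on the algebra `N`, with respect to the
trace `τ`: it belongs to `N` and reproduces the expectation value in `μ` of every positive
element of `N` (hence of every element, by linearity). -/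
structure IsReducedDensityMatrix (τ : (K →L[ℂ] K) → ℝ≥0∞) (N : VonNeumannAlgebra K)
    (μ ρ : K →L[ℂ] K) : Prop where
  mem : ρ ∈ N
  nonneg : 0 ≤ ρ
  expectation : ∀ B ∈ N, 0 ≤ B → pairing τ ρ B = pairing (hilbertTrace K) μ B

/-- The von Neumann entropy `-Tr (ρ log ρ)`, with respect to the trace `τ`. It is the difference of
the traces of the positive and negative parts of `-ρ log ρ`; the second is finite when `τ ρ` is
and it vanishes when `ρ ≤ 1`. -/
def vonNeumannEntropy (τ : (K →L[ℂ] K) → ℝ≥0∞) (ρ : K →L[ℂ] K) : EReal :=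
  (τ (cfc (fun x : ℝ => max (Real.negMulLog x) 0) ρ) : EReal)
    - (τ (cfc (fun x : ℝ => max (-Real.negMulLog x) 0) ρ) : EReal)

end Entropy

end NullInfinity

end

/-!
The algebra of a segment `(u₁, u₂)` does not depend on `u₂`. Passing to commutants, it suffices
that a bounded operator `X` which commutes with all fields in `(u₁, u₂)` commutes with all fields in
`(u₁, ∞)`. As the smeared fields are essentially self-adjoint, this can be tested on the form
`commForm X A φ ψ = ⟪φ, X A ψ⟫ - ⟪A φ, X ψ⟫` on the common domain.

For the radiative fields, choose `g` with integral one, supported in a short interval to the right of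
`u₁` but to the left of a given test function `f`. The unitary group `U s` of `∫ g(u) M(u) du` acts
on fields to the right of the support of `g` by translation, up to local operators with which `X`
commutes. Hence, with `κ = 4πG` and `f_s (u) = f (u - κ s)`, the form of `X` with `Φ(f_s)` between
`U s φ` and `U s ψ` does not depend on `s` (`BondiMassLaws.commForm_eq_zero_of_translate`). The
derivative exists because `s ↦ Φ(f) U s ψ` is strongly differentiable: its weak derivative
`i Φ(f) U s M(g) ψ` is of the same type as the function itself, so the local bounds on the fields
along orbits make both continuous (`hasDerivAt_field_orbit`). A test function in `(u₁, ∞)` is a sum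
of pieces narrow enough to be translated into `(u₁, u₂)` (`TestFn.property_of_translate`). For the
Bondi mass aspect, the evolution law expresses `∂_u m_B` through the radiative fields, so `X`
commutes with `∂_u m_B`. Hence the form of `X` with `m_B` is invariant under translations, and
the same decomposition applies.

That bounded operators in the commutant of a generated algebra commute with the closures of the
generators (`mem_commutant_generatedAlgebra`) is seen from the orthogonal projections onto the
closed graphs of the generators.

Finally, reduced density matrices with respect to a faithful trace `τ` are unique, so that their
entropies agree: if `ρ` and `ρ'` are two of them and `P` is the positive part of `ρ - ρ'`, then `P`
has the same expectation value in both, while by traciality the difference is `τ (P ^ 2)`.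
-/

noncomputable section

namespace NullInfinity

/-! ### Commutants of families of operators on a common domain -/

section Commutant

variable {K : Type*} [NormedAddCommGroup K] [InnerProductSpace ℂ K] {D : Submodule ℂ K}

/-- The closed graph of `A`, as a closed subspace of the Hilbert space `K ⊕ K`. -/
def graphSubmodule (A : D →ₗ[ℂ] D) : Submodule ℂ (WithLp 2 (K × K)) :=
  (LinearMap.range ((WithLp.linearEquiv 2 ℂ (K × K)).symm.toLinearMap ∘ₗ
    (D.subtype.prod (D.subtype ∘ₗ A)))).topologicalClosure

theorem mem_graphSubmodule (A : D →ₗ[ℂ] D) (a b : K) :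
    WithLp.toLp 2 (a, b) ∈ graphSubmodule A ↔ (a, b) ∈ closedGraph A := by
  have hr : (LinearMap.range ((WithLp.linearEquiv 2 ℂ (K × K)).symm.toLinearMap ∘ₗ
      (D.subtype.prod (D.subtype ∘ₗ A))) : Set (WithLp 2 (K × K))) =
      (WithLp.prodContinuousLinearEquiv 2 ℂ K K).symm.toHomeomorph ''
        {p | ∃ χ : D, p = ((χ : K), (A χ : K))} := by
    ext z
    simp only [LinearMap.coe_range, Set.mem_range, Set.mem_image, Set.mem_ofPred_eq]
    constructor
    · rintro ⟨χ, rfl⟩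
      exact ⟨_, ⟨χ, rfl⟩, rfl⟩
    · rintro ⟨_, ⟨χ, rfl⟩, rfl⟩
      exact ⟨χ, rfl⟩
  rw [graphSubmodule, ← SetLike.mem_coe, Submodule.topologicalClosure_coe, hr,
    ← Homeomorph.image_closure]
  constructor
  · rintro ⟨p, hp, h⟩
    have : p = (a, b) := (WithLp.prodContinuousLinearEquiv 2 ℂ K K).symm.injective h
    exact this ▸ hp
  · exact fun h => ⟨_, h, rfl⟩

theorem CommutesWithClosure.map_closedGraph {X : K →L[ℂ] K} {A : D →ₗ[ℂ] D}
    (h : CommutesWithClosure X A) {p : K × K} (hp : p ∈ closedGraph A) :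
    (X p.1, X p.2) ∈ closedGraph A := by
  have hm : Set.MapsTo (fun p : K × K => (X p.1, X p.2))
      {p | ∃ χ : D, p = ((χ : K), (A χ : K))} (closedGraph A) := by
    rintro _ ⟨χ, rfl⟩
    exact h χ
  exact hm.closure_left (by fun_prop) isClosed_closure hp

/-- If `B` is a formal adjoint of `A`, it remains one when tested on the closure of `A`. -/
theorem inner_eq_of_mem_closedGraph {A B : D →ₗ[ℂ] D}
    (hAB : ∀ φ ψ : D, ⟪(B φ : K), (ψ : K)⟫_ℂ = ⟪(φ : K), (A ψ : K)⟫_ℂ) {p : K × K}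
    (hp : p ∈ closedGraph A) (φ : D) : ⟪(B φ : K), p.1⟫_ℂ = ⟪(φ : K), p.2⟫_ℂ := by
  have hc : IsClosed {p : K × K | ⟪(B φ : K), p.1⟫_ℂ = ⟪(φ : K), p.2⟫_ℂ} :=
    isClosed_eq (by fun_prop) (by fun_prop)
  refine closure_minimal ?_ hc hp
  rintro _ ⟨χ, rfl⟩
  exact hAB φ χ

/-- The commutator of the bounded operator `X` with `A`, as a sesquilinear form on `D`; it makes
sense although `X` need not preserve `D`. -/
def commForm (X : K →L[ℂ] K) (A : D →ₗ[ℂ] D) (φ ψ : D) : ℂ :=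
  ⟪(φ : K), X (A ψ)⟫_ℂ - ⟪(A φ : K), X ψ⟫_ℂ

theorem commForm_add (X : K →L[ℂ] K) (A B : D →ₗ[ℂ] D) (φ ψ : D) :
    commForm X (A + B) φ ψ = commForm X A φ ψ + commForm X B φ ψ := by
  simp only [commForm, LinearMap.add_apply, Submodule.coe_add, map_add, inner_add_left,
    inner_add_right]
  ring

theorem CommutesWithClosure.commForm_eq_zero {X : K →L[ℂ] K} {A : D →ₗ[ℂ] D}
    (h : CommutesWithClosure X A) (hA : IsSymmetricOn A) (φ ψ : D) : commForm X A φ ψ = 0 :=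
  sub_eq_zero.2 (inner_eq_of_mem_closedGraph hA (h ψ) φ).symm

/-- For an essentially self-adjoint operator, vanishing of the commutator in the sense of forms on
the domain is enough for commuting with the closure. -/
theorem commutesWithClosure_of_commForm {X : K →L[ℂ] K} {A : D →ₗ[ℂ] D}
    (hA : IsEssSelfAdjointOn A) (h : ∀ φ ψ, commForm X A φ ψ = 0) : CommutesWithClosure X A :=
  fun ψ => hA.2 _ _ fun φ => (sub_eq_zero.1 (h φ ψ)).symm

variable [CompleteSpace K]

instance (A : D →ₗ[ℂ] D) : CompleteSpace (graphSubmodule A) :=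
  (Submodule.isClosed_topologicalClosure _).completeSpace_coe

/-- The blocks of the orthogonal projection onto the closed graph of `A`, obtained by composing it
with an inclusion `K → K ⊕ K` and a projection `K ⊕ K → K`. -/
def graphBlock (A : D →ₗ[ℂ] D) (p : WithLp 2 (K × K) →L[ℂ] K) (i : K →L[ℂ] K × K) : K →L[ℂ] K :=
  p ∘L (graphSubmodule A).starProjection ∘L
    (WithLp.prodContinuousLinearEquiv 2 ℂ K K).symm.toContinuousLinearMap ∘L i

/-- An operator which together with its adjoint commutes with the closure of `A` commutes with the
projection onto its graph. -/
theorem starProjection_map {X : K →L[ℂ] K} {A : D →ₗ[ℂ] D} (h : CommutesWithClosure X A)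
    (h' : CommutesWithClosure (star X) A) (z : WithLp 2 (K × K)) :
    (graphSubmodule A).starProjection (WithLp.toLp 2 (X z.fst, X z.snd)) =
      WithLp.toLp 2 (X ((graphSubmodule A).starProjection z).fst,
        X ((graphSubmodule A).starProjection z).snd) := by
  refine Submodule.eq_starProjection_of_mem_of_inner_eq_zero (K := graphSubmodule A) ?_ ?_
  · rw [mem_graphSubmodule]
    exact h.map_closedGraph ((mem_graphSubmodule A _ _).1
      (Submodule.starProjection_apply_mem (graphSubmodule A) z))
  · intro w hw
    have hw' : WithLp.toLp 2 (star X w.fst, star X w.snd) ∈ graphSubmodule A := by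
      rw [mem_graphSubmodule]
      exact h'.map_closedGraph ((mem_graphSubmodule A _ _).1 hw)
    have := (graphSubmodule A).starProjection_inner_eq_zero z _ hw'
    simp only [WithLp.prod_inner_apply, ContinuousLinearMap.star_eq_adjoint,
      ContinuousLinearMap.adjoint_inner_right] at this
    simpa [WithLp.prod_inner_apply, map_sub] using this

theorem commutesWithClosure_of_commute_graphBlock {X : K →L[ℂ] K} {A : D →ₗ[ℂ] D}
    (h : ∀ p, (p = WithLp.fstL 2 ℂ K K ∨ p = WithLp.sndL 2 ℂ K K) →
      ∀ i, (i = .inl ℂ K K ∨ i = .inr ℂ K K) → Commute X (graphBlock A p i)) :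
    CommutesWithClosure X A := by
  intro ψ
  set P := (graphSubmodule A).starProjection
  have hmem : WithLp.toLp 2 ((ψ : K), (A ψ : K)) ∈ graphSubmodule A :=
    (mem_graphSubmodule A _ _).2 (subset_closure ⟨ψ, rfl⟩)
  have hfix : P (WithLp.toLp 2 ((ψ : K), (A ψ : K))) = WithLp.toLp 2 ((ψ : K), (A ψ : K)) :=
    Submodule.starProjection_eq_self_iff.2 hmem
  have hsplit : ∀ a b : K, WithLp.toLp 2 (a, b) = WithLp.toLp 2 (a, 0) + WithLp.toLp 2 (0, b) := by
    intro a b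
    rw [← WithLp.toLp_add]
    simp
  have key : ∀ p, (p = WithLp.fstL 2 ℂ K K ∨ p = WithLp.sndL 2 ℂ K K) → ∀ a b : K,
      p (P (WithLp.toLp 2 (X a, X b))) = X (p (P (WithLp.toLp 2 (a, b)))) := by
    intro p hp a b
    have h1 := congrArg (fun T : K →L[ℂ] K => T a) (h p hp _ (Or.inl rfl)).eq
    have h2 := congrArg (fun T : K →L[ℂ] K => T b) (h p hp _ (Or.inr rfl)).eq
    rw [hsplit, hsplit a b]
    simp only [map_add]
    exact (congrArg₂ (· + ·) h1 h2).symm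
  rw [← mem_graphSubmodule, ← Submodule.starProjection_eq_self_iff]
  have h1 := key _ (Or.inl rfl) (ψ : K) (A ψ : K)
  have h2 := key _ (Or.inr rfl) (ψ : K) (A ψ : K)
  rw [hfix] at h1 h2
  exact WithLp.ofLp_injective 2 (Prod.ext h1 h2)

/-- The operators in the commutant of the algebra generated by `F` are exactly those which, with
their adjoints, commute with the closures of the members of `F`: the latter operators form a von
Neumann algebra, as the commutant of the blocks of the graph projections. -/
theorem mem_commutant_generatedAlgebra {F : Set (D →ₗ[ℂ] D)} {X : K →L[ℂ] K} :
    X ∈ (generatedAlgebra F).commutant ↔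
      ∀ A ∈ F, CommutesWithClosure X A ∧ CommutesWithClosure (star X) A := by
  have main : ∀ X ∈ (generatedAlgebra F).commutant, ∀ A ∈ F, CommutesWithClosure X A := by
    intro X hX A hA
    refine commutesWithClosure_of_commute_graphBlock fun p hp i hi => ?_
    have hblock : ∀ Y : K →L[ℂ] K, CommutesWithClosure Y A → CommutesWithClosure (star Y) A →
        Y * graphBlock A p i = graphBlock A p i * Y := by
      intro Y h h'
      ext a
      rcases hp with rfl | rfl <;> rcases hi with rfl | rfl
      all_goals
        simp only [graphBlock, mul_apply_eq_comp, ContinuousLinearMap.comp_apply,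
          ContinuousLinearMap.inl_apply, ContinuousLinearMap.inr_apply]
      · have := starProjection_map h h' (WithLp.toLp 2 (a, 0))
        simpa using (congrArg (WithLp.fstL 2 ℂ K K) this).symm
      · have := starProjection_map h h' (WithLp.toLp 2 (0, a))
        simpa using (congrArg (WithLp.fstL 2 ℂ K K) this).symm
      · have := starProjection_map h h' (WithLp.toLp 2 (a, 0))
        simpa using (congrArg (WithLp.sndL 2 ℂ K K) this).symm
      · have := starProjection_map h h' (WithLp.toLp 2 (0, a))
        simpa using (congrArg (WithLp.sndL 2 ℂ K K) this).symm
    have hmem : graphBlock A p i ∈ generatedAlgebra F := by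
      change graphBlock A p i ∈ StarSubalgebra.centralizer ℂ _
      rw [StarSubalgebra.mem_centralizer_iff]
      intro Y hY
      exact ⟨hblock Y (hY A hA).1 (hY A hA).2,
        hblock (star Y) (hY A hA).2 (by rw [star_star]; exact (hY A hA).1)⟩
    exact (VonNeumannAlgebra.mem_commutant_iff.1 hX _ hmem).symm
  refine ⟨fun hX A hA => ⟨main X hX A hA, main _ (star_mem hX) A hA⟩, fun h => ?_⟩
  rw [VonNeumannAlgebra.mem_commutant_iff]
  intro Y hY
  exact ((StarSubalgebra.mem_centralizer_iff ℂ).1 hY X h).1.symm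

end Commutant

/-! ### Uniqueness of reduced density matrices -/

section Uniqueness

variable {K : Type*} [NormedAddCommGroup K] [InnerProductSpace ℂ K]

theorem re_inner_nonneg_of_nonneg {A : K →L[ℂ] K} (hA : 0 ≤ A) (x : K) :
    0 ≤ (⟪x, A x⟫_ℂ).re :=
  ((ContinuousLinearMap.nonneg_iff_isPositive A).1 hA).re_inner_nonneg_right x

/-- Parseval's identity in extended nonnegative reals. -/
theorem ofReal_norm_sq_eq_tsum {w : Set K} (b : HilbertBasis w ℂ K) (x : K) :
    ENNReal.ofReal (‖x‖ ^ 2) = ∑' i, ENNReal.ofReal (‖⟪b i, x⟫_ℂ‖ ^ 2) := by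
  have h : HasSum (fun i => ‖⟪b i, x⟫_ℂ‖ ^ 2) (‖x‖ ^ 2) := by
    have h1 := Complex.hasSum_re (b.hasSum_inner_mul_inner x x)
    have h2 : (⟪x, x⟫_ℂ).re = ‖x‖ ^ 2 := by
      rw [inner_self_eq_norm_sq_to_K]
      norm_cast
    rw [h2] at h1
    refine h1.congr_fun ?_
    intro i
    rw [← inner_conj_symm x (b i), ← Complex.normSq_eq_conj_mul_self, Complex.ofReal_re,
      Complex.normSq_eq_norm_sq]
  rw [← h.tsum_eq, ENNReal.ofReal_tsum_of_nonneg (fun _ => by positivity) h.summable]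

variable [CompleteSpace K]

theorem cfc_mem {N : VonNeumannAlgebra K} {A : K →L[ℂ] K} (hA : A ∈ N) (f : ℝ → ℝ) :
    cfc f A ∈ N := by
  rw [← VonNeumannAlgebra.commutant_commutant N, VonNeumannAlgebra.mem_commutant_iff]
  intro X hX
  have : Commute A X := VonNeumannAlgebra.mem_commutant_iff.1 hX A hA
  exact (this.cfc_real f).eq.symm

theorem sqrt_mem {N : VonNeumannAlgebra K} {A : K →L[ℂ] K} (hA : A ∈ N) (h0 : 0 ≤ A) :
    CFC.sqrt A ∈ N := by
  rw [CFC.sqrt_eq_real_sqrt A h0, cfcₙ_eq_cfc]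
  exact cfc_mem hA _

/-- The part of the notion of a faithful trace that determines reduced density matrices. -/
structure IsFaithfulTraceOn (N : VonNeumannAlgebra K) (τ : (K →L[ℂ] K) → ℝ≥0∞) : Prop where
  add : ∀ A ∈ N, ∀ B ∈ N, 0 ≤ A → 0 ≤ B → τ (A + B) = τ A + τ B
  tracial : ∀ A ∈ N, τ (star A * A) = τ (A * star A)
  faithful : ∀ A ∈ N, 0 ≤ A → τ A = 0 → A = 0

theorem IsFaithfulNormalTrace.isFaithfulTraceOn {N : VonNeumannAlgebra K}
    {τ : (K →L[ℂ] K) → ℝ≥0∞} (h : IsFaithfulNormalTrace N τ) : IsFaithfulTraceOn N τ :=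
  ⟨h.add, h.tracial, h.faithful⟩

theorem exists_hilbertTrace_eq_tsum : ∃ (w : Set K) (b : HilbertBasis w ℂ K),
    ∀ A : K →L[ℂ] K, hilbertTrace K A = ∑' i, ENNReal.ofReal (⟪b i, A (b i)⟫_ℂ).re :=
  ⟨_, (exists_hilbertBasis ℂ K).choose_spec.choose, fun _ => rfl⟩

theorem re_inner_star_mul_self (A : K →L[ℂ] K) (x : K) :
    (⟪x, (star A * A) x⟫_ℂ).re = ‖A x‖ ^ 2 := by
  rw [mul_apply_eq_comp, ContinuousLinearMap.star_eq_adjoint,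
    ContinuousLinearMap.adjoint_inner_right, inner_self_eq_norm_sq_to_K]
  norm_cast

theorem isFaithfulTraceOn_hilbertTrace (N : VonNeumannAlgebra K) :
    IsFaithfulTraceOn N (hilbertTrace K) := by
  obtain ⟨w, b, hb⟩ := exists_hilbertTrace_eq_tsum (K := K)
  refine ⟨?_, ?_, ?_⟩
  · intro A _ B _ hA hB
    rw [hb, hb, hb, ← ENNReal.tsum_add]
    refine tsum_congr fun i => ?_
    rw [← ENNReal.ofReal_add (re_inner_nonneg_of_nonneg hA _) (re_inner_nonneg_of_nonneg hB _),
      add_apply, inner_add_right, Complex.add_re]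
  · intro A _
    rw [hb, hb]
    have h2 : ∀ x, (⟪x, (A * star A) x⟫_ℂ).re = ‖star A x‖ ^ 2 := by
      intro x
      rw [← re_inner_star_mul_self (star A), star_star]
    simp_rw [re_inner_star_mul_self, h2, ofReal_norm_sq_eq_tsum b]
    rw [ENNReal.tsum_comm]
    refine tsum_congr fun i => tsum_congr fun j => ?_
    rw [ContinuousLinearMap.star_eq_adjoint, ContinuousLinearMap.adjoint_inner_right,
      norm_inner_symm]
  · intro A _ hA h0
    rw [hb, ENNReal.tsum_eq_zero] at h0
    have hs : CFC.sqrt A * CFC.sqrt A = A := CFC.sqrt_mul_sqrt_self A hA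
    have hsa : star (CFC.sqrt A) = CFC.sqrt A := (CFC.sqrt_nonneg A).isSelfAdjoint.star_eq
    have hz : ∀ i, CFC.sqrt A (b i) = 0 := by
      intro i
      have h1 := re_inner_star_mul_self (CFC.sqrt A) (b i)
      rw [hsa, hs] at h1
      have h2 := h0 i
      rw [h1, ENNReal.ofReal_eq_zero] at h2
      exact norm_eq_zero.1 (pow_eq_zero_iff two_ne_zero |>.1 (le_antisymm h2 (by positivity)))
    have hd : Dense (Submodule.span ℂ (Set.range b) : Set K) :=
      Submodule.dense_iff_topologicalClosure_eq_top.2 b.dense_span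
    have hS : CFC.sqrt A = 0 := by
      refine ContinuousLinearMap.ext_on hd ?_
      rintro _ ⟨i, rfl⟩
      simpa using hz i
    rw [← hs, hS, mul_zero]

/-- Expectation values of bounded observables in a density matrix are finite. -/
theorem pairing_hilbertTrace_ne_top {μ : K →L[ℂ] K} (hμ : IsDensityMatrix μ) (B : K →L[ℂ] K) :
    pairing (hilbertTrace K) μ B ≠ ⊤ := by
  obtain ⟨w, b, hb⟩ := exists_hilbertTrace_eq_tsum (K := K)
  have hs : CFC.sqrt μ * CFC.sqrt μ = μ := CFC.sqrt_mul_sqrt_self μ hμ.1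
  have hsa : star (CFC.sqrt μ) = CFC.sqrt μ := (CFC.sqrt_nonneg μ).isSelfAdjoint.star_eq
  have hle : pairing (hilbertTrace K) μ B ≤ ENNReal.ofReal ‖B‖ * hilbertTrace K μ := by
    rw [pairing, hb, hb, ← ENNReal.tsum_mul_left]
    refine ENNReal.tsum_le_tsum fun i => ?_
    rw [← ENNReal.ofReal_mul (norm_nonneg _)]
    refine ENNReal.ofReal_le_ofReal ?_
    have h1 := re_inner_star_mul_self (CFC.sqrt μ) (b i)
    rw [hsa, hs] at h1
    rw [h1, mul_apply_eq_comp, mul_apply_eq_comp]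
    nth_rewrite 1 [← hsa]
    rw [ContinuousLinearMap.star_eq_adjoint, ContinuousLinearMap.adjoint_inner_right]
    refine (Complex.re_le_norm _).trans ((norm_inner_le_norm _ _).trans ?_)
    nlinarith [B.le_opNorm (CFC.sqrt μ (b i)), norm_nonneg (CFC.sqrt μ (b i))]
  rw [hμ.2, mul_one] at hle
  exact ne_top_of_le_ne_top ENNReal.ofReal_ne_top hle

theorem pairing_mul_self {N : VonNeumannAlgebra K} {τ : (K →L[ℂ] K) → ℝ≥0∞}
    (hτ : IsFaithfulTraceOn N τ) {ρ S : K →L[ℂ] K} (hρ : ρ ∈ N) (h0 : 0 ≤ ρ) (hS : S ∈ N)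
    (hsa : IsSelfAdjoint S) : pairing τ ρ (S * S) = τ (S * ρ * S) := by
  have hs : CFC.sqrt ρ * CFC.sqrt ρ = ρ := CFC.sqrt_mul_sqrt_self ρ h0
  have hsr : star (CFC.sqrt ρ) = CFC.sqrt ρ := (CFC.sqrt_nonneg ρ).isSelfAdjoint.star_eq
  have := hτ.tracial (S * CFC.sqrt ρ) (mul_mem hS (sqrt_mem hρ h0))
  rw [star_mul, hsr, hsa.star_eq] at this
  have h1 : S * CFC.sqrt ρ * (CFC.sqrt ρ * S) = S * ρ * S := by
    rw [mul_assoc, ← mul_assoc (CFC.sqrt ρ), hs, mul_assoc]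
  rw [h1] at this
  rw [← this, pairing]
  simp only [mul_assoc]

/-- Two reduced density matrices of the same state are ordered, hence equal by symmetry: with
`δ = ρ - ρ'` and `δ₊` its positive part, the observable `δ₊` has the same finite expectation value
in both, but these expectation values differ by `τ (δ₊ ^ 2)`. -/
theorem IsReducedDensityMatrix.le {N : VonNeumannAlgebra K} {τ : (K →L[ℂ] K) → ℝ≥0∞}
    (hτ : IsFaithfulTraceOn N τ) {μ ρ ρ' : K →L[ℂ] K} (hμ : IsDensityMatrix μ)
    (h : IsReducedDensityMatrix τ N μ ρ) (h' : IsReducedDensityMatrix τ N μ ρ') : ρ ≤ ρ' := by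
  set δ := ρ - ρ' with hδ
  have hδN : δ ∈ N := sub_mem h.mem h'.mem
  have hδsa : IsSelfAdjoint δ := h.nonneg.isSelfAdjoint.sub h'.nonneg.isSelfAdjoint
  set S := cfc (fun x : ℝ => √(max x 0)) δ with hSdef
  set P := cfc (fun x : ℝ => max x 0) δ with hPdef
  have hSN : S ∈ N := cfc_mem hδN _
  have hPN : P ∈ N := cfc_mem hδN _
  have hSsa : IsSelfAdjoint S := cfc_predicate _ _
  have hPsa : IsSelfAdjoint P := cfc_predicate _ _
  have hSS : S * S = P := by
    rw [hSdef, ← cfc_mul _ _ δ]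
    exact cfc_congr fun x _ => Real.mul_self_sqrt (le_max_right _ _)
  have hSδS : S * δ * S = P * P := by
    have hid : δ = cfc (fun x : ℝ => x) δ := (cfc_id' ℝ δ).symm
    calc S * δ * S = S * cfc (fun x : ℝ => x) δ * S := by rw [← hid]
      _ = P * P := by
        rw [hSdef, hPdef, ← cfc_mul _ _ δ, ← cfc_mul _ _ δ, ← cfc_mul _ _ δ]
        refine cfc_congr fun x _ => ?_
        rcases le_total x 0 with hx | hx
        · simp [hx]
        · simp only [max_eq_left hx]
          rw [mul_right_comm, Real.mul_self_sqrt hx]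
  have hPP : 0 ≤ P * P := by
    have := star_mul_self_nonneg P
    rwa [hPsa.star_eq] at this
  have hSS0 : 0 ≤ S * S := by
    have := star_mul_self_nonneg S
    rwa [hSsa.star_eq] at this
  have hSρS : S * ρ * S = S * ρ' * S + P * P := by
    rw [← hSδS, hδ]
    noncomm_ring
  have hpos : 0 ≤ S * ρ' * S := by
    have := star_left_conjugate_nonneg h'.nonneg S
    rwa [hSsa.star_eq] at this
  have e1 := h.expectation (S * S) (mul_mem hSN hSN) hSS0
  have e2 := h'.expectation (S * S) (mul_mem hSN hSN) hSS0
  rw [pairing_mul_self hτ h.mem h.nonneg hSN hSsa, hSρS,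
    hτ.add _ (mul_mem (mul_mem hSN h'.mem) hSN) _ (mul_mem hPN hPN) hpos hPP,
    ← pairing_mul_self hτ h'.mem h'.nonneg hSN hSsa, e2] at e1
  have h0 : τ (P * P) = 0 := by
    have hfin := pairing_hilbertTrace_ne_top hμ (S * S)
    exact (ENNReal.add_right_inj hfin).1 (by rw [e1, add_zero])
  have hP0 : P = 0 := by
    have := hτ.faithful _ (mul_mem hPN hPN) hPP h0
    rw [← CStarRing.star_mul_self_eq_zero_iff, hPsa.star_eq, this]
  have hle : δ ≤ P := by
    conv_lhs => rw [← cfc_id' ℝ δ]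
    exact cfc_mono fun x _ => le_max_left _ _
  rw [hP0, hδ, sub_nonpos] at hle
  exact hle

theorem IsReducedDensityMatrix.unique {N : VonNeumannAlgebra K} {τ : (K →L[ℂ] K) → ℝ≥0∞}
    (hτ : IsFaithfulTraceOn N τ) {μ ρ ρ' : K →L[ℂ] K} (hμ : IsDensityMatrix μ)
    (h : IsReducedDensityMatrix τ N μ ρ) (h' : IsReducedDensityMatrix τ N μ ρ') : ρ = ρ' :=
  le_antisymm (h.le hτ hμ h') (h'.le hτ hμ h)

end Uniqueness

/-! ### Translations and cutoffs of test functions -/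

section TestFunctions

open Filter Topology

/-- All values of `f` outside `[a, b] × ℝ³` vanish. -/
def TestFn.VanishesOff (f : TestFn) (a b : ℝ) : Prop :=
  ∀ p : ℝ × E3, p.1 ∉ Set.Icc a b → f.1 p = 0

theorem TestFn.VanishesOff.supportedIn {f : TestFn} {a b v w : ℝ} (h : TestFn.VanishesOff f a b)
    (ha : v < a) (hb : b < w) : TestFn.SupportedIn f (Set.Ioo v w) := by
  refine (closure_minimal ?_ isClosed_Icc).trans (Set.Icc_subset_Ioo ha hb)
  rintro _ ⟨p, hp, rfl⟩
  by_contra hn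
  exact hp (h p hn)

theorem TestFn.SupportedIn.exists_vanishesOff {f : TestFn} {v w : ℝ} (hvw : v < w)
    (h : TestFn.SupportedIn f (Set.Ioo v w)) : ∃ a b, v < a ∧ b < w ∧ TestFn.VanishesOff f a b := by
  obtain ⟨R, hR⟩ := f.2.2
  have hc : IsCompact (closure (Prod.fst '' Function.support f.1)) := by
    refine (isCompact_Icc (a := -R) (b := R)).of_isClosed_subset isClosed_closure
      (closure_minimal ?_ isClosed_Icc)
    rintro _ ⟨p, hp, rfl⟩
    by_contra hn
    exact hp (hR p (by rwa [Set.mem_Icc, ← abs_le, not_le] at hn))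
  rcases (closure (Prod.fst '' Function.support f.1)).eq_empty_or_nonempty with he | hne
  · refine ⟨(v + w) / 2, (v + w) / 2, by linarith, by linarith, fun p _ => ?_⟩
    by_contra hn
    have : p.1 ∈ closure (Prod.fst '' Function.support f.1) := subset_closure ⟨p, hn, rfl⟩
    rw [he] at this
    exact this
  · obtain ⟨a, ha⟩ := hc.exists_isLeast hne
    obtain ⟨b, hb⟩ := hc.exists_isGreatest hne
    refine ⟨a, b, (h ha.1).1, (h hb.1).2, fun p hp => ?_⟩
    by_contra hn
    have : p.1 ∈ closure (Prod.fst '' Function.support f.1) := subset_closure ⟨p, hn, rfl⟩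
    exact hp ⟨ha.2 this, hb.2 this⟩

theorem TestFn.dir_eq_zero {f : TestFn} {s : Set (ℝ × E3)} (hs : IsOpen s)
    (hf : ∀ p ∈ s, f.1 p = 0) (v : ℝ × E3) {p : ℝ × E3} (hp : p ∈ s) :
    (TestFn.dir v f).1 p = 0 := by
  have hev : f.1 =ᶠ[𝓝 p] fun _ => (0 : ℝ) := by
    filter_upwards [hs.mem_nhds hp] with q hq using hf q hq
  simp [TestFn.dir, hev.fderiv_eq]

theorem TestFn.iteratedFDeriv_eq_zero {f : TestFn} {s : Set (ℝ × E3)} (hs : IsOpen s)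
    (hf : ∀ p ∈ s, f.1 p = 0) (k : ℕ) {p : ℝ × E3} (hp : p ∈ s) :
    iteratedFDeriv ℝ k f.1 p = 0 := by
  have hev : f.1 =ᶠ[𝓝 p] 0 := by
    filter_upwards [hs.mem_nhds hp] with q hq using hf q hq
  rw [(hev.iteratedFDeriv ℝ k).eq_of_nhds]
  simp

theorem isOpen_lt_abs_fst (R : ℝ) : IsOpen {p : ℝ × E3 | R < |p.1|} :=
  isOpen_lt continuous_const (continuous_abs.comp continuous_fst)

theorem TestFn.exists_norm_iteratedFDeriv_le (f : TestFn) (N : ℕ) :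
    ∃ B : ℝ, ∀ k ≤ N, ∀ (u : ℝ) (x : E3), ‖x‖ = 1 → ‖iteratedFDeriv ℝ k f.1 (u, x)‖ ≤ B := by
  obtain ⟨hf, R, hR⟩ := f.2
  have hcpt : IsCompact (Set.Icc (-R) R ×ˢ Metric.sphere (0 : E3) 1) :=
    isCompact_Icc.prod (isCompact_sphere 0 1)
  have h : ∀ k : ℕ, ∃ B : ℝ, ∀ (u : ℝ) (x : E3), ‖x‖ = 1 →
      ‖iteratedFDeriv ℝ k f.1 (u, x)‖ ≤ B := by
    intro k
    obtain ⟨B, hB⟩ := hcpt.exists_bound_of_continuousOn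
      (hf.continuous_iteratedFDeriv (m := k) (by exact_mod_cast le_top)).continuousOn
    refine ⟨max B 0, fun u x hx => ?_⟩
    by_cases hu : |u| ≤ R
    · exact (hB (u, x) ⟨abs_le.1 hu, by simpa using hx⟩).trans (le_max_left _ _)
    · rw [TestFn.iteratedFDeriv_eq_zero (isOpen_lt_abs_fst R) hR k (not_le.1 hu), norm_zero]
      exact le_max_right _ _
  choose B hB using h
  obtain ⟨C, hC⟩ := ((Set.finite_Iic N).image B).bddAbove
  exact ⟨C, fun k hk u x hx => (hB k u x hx).trans (hC ⟨k, hk, rfl⟩)⟩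

theorem TestFn.VanishesOff.dir {f : TestFn} {a b : ℝ} (h : TestFn.VanishesOff f a b)
    (v : ℝ × E3) : TestFn.VanishesOff (TestFn.dir v f) a b := fun _ hp =>
  TestFn.dir_eq_zero (isClosed_Icc.isOpen_compl.preimage continuous_fst) h v hp

/-- The translate `f (u + t, x)` along null infinity. -/
def TestFn.translate (t : ℝ) (f : TestFn) : TestFn :=
  ⟨fun p => f.1 (p + (t, 0)), by
    obtain ⟨hf, R, hR⟩ := f.2
    refine ⟨hf.comp (contDiff_id.add contDiff_const), R + |t|, fun p hp => hR _ ?_⟩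
    have := abs_sub_abs_le_abs_sub p.1 (-t)
    rw [abs_neg, sub_neg_eq_add] at this
    simp only [Prod.fst_add]
    linarith⟩

theorem TestFn.translate_zero (f : TestFn) : TestFn.translate 0 f = f := by
  apply Subtype.ext
  funext p
  change f.1 (p + (0, 0)) = f.1 p
  rw [Prod.mk_zero_zero, add_zero]

theorem TestFn.translate_translate (s t : ℝ) (f : TestFn) :
    TestFn.translate s (TestFn.translate t f) = TestFn.translate (s + t) f := by
  apply Subtype.ext
  funext p
  change f.1 (p + (s, 0) + (t, 0)) = f.1 (p + (s + t, 0))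
  rw [add_assoc, Prod.mk_add_mk (a₁ := s), add_zero]

theorem TestFn.VanishesOff.translate {f : TestFn} {a b : ℝ} (h : TestFn.VanishesOff f a b) (t : ℝ) :
    TestFn.VanishesOff (TestFn.translate t f) (a - t) (b - t) := by
  intro p hp
  refine h _ fun hq => hp ?_
  simp only [Prod.fst_add, Set.mem_Icc] at hq ⊢
  exact ⟨by linarith [hq.1], by linarith [hq.2]⟩

/-- A product with the primitive of `g` is trivial to the right of the support of `g`, if `g` has
integral one. -/
theorem TestFn.VanishesOff.mulPrimitive_eq {f : TestFn} {a b : ℝ} (h : TestFn.VanishesOff f a b)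
    {g : TimeFn} (hg : ∀ u, a ≤ u → g.primitive u = 1) : TestFn.mulPrimitive g f = f := by
  apply Subtype.ext
  funext p
  change g.primitive p.1 * f.1 p = f.1 p
  by_cases hp : p.1 ∈ Set.Icc a b
  · rw [hg _ hp.1, one_mul]
  · rw [h p hp, mul_zero]

/-- A smooth cutoff splits a test function vanishing off `[a, b]` at any `c < d` into a part
vanishing off `[a, d]` and one vanishing off `[c, b]`. -/
theorem TestFn.VanishesOff.exists_add {f : TestFn} {a b c d : ℝ} (h : TestFn.VanishesOff f a b)
    (hcd : c < d) : ∃ f₁ f₂ : TestFn, f = f₁ + f₂ ∧ TestFn.VanishesOff f₁ a d ∧ TestFn.VanishesOff f₂ c b := by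
  set χ : ℝ × E3 → ℝ := fun p => Real.smoothTransition ((d - p.1) / (d - c)) with hχ
  have hχs : ContDiff ℝ ∞ χ :=
    Real.smoothTransition.contDiff.comp ((contDiff_const.sub contDiff_fst).div_const _)
  have h0 : ∀ p : ℝ × E3, d < p.1 → χ p = 0 := fun p hp =>
    Real.smoothTransition.zero_of_nonpos
      (div_nonpos_of_nonpos_of_nonneg (by linarith) (by linarith))
  have h1 : ∀ p : ℝ × E3, p.1 < c → χ p = 1 := fun p hp =>
    Real.smoothTransition.one_of_one_le (by rw [le_div_iff₀ (by linarith)]; linarith)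
  refine ⟨TestFn.mulSmooth χ hχs f, TestFn.mulSmooth (fun p => 1 - χ p) (contDiff_const.sub hχs) f,
    ?_, ?_, ?_⟩
  · apply Subtype.ext
    funext p
    change f.1 p = χ p * f.1 p + (1 - χ p) * f.1 p
    ring
  · intro p hp
    change χ p * f.1 p = 0
    by_cases hq : p.1 ∈ Set.Icc a b
    · rw [h0 p (not_le.1 fun hd => hp ⟨hq.1, hd⟩), zero_mul]
    · rw [h p hq, mul_zero]
  · intro p hp
    change (1 - χ p) * f.1 p = 0
    by_cases hq : p.1 ∈ Set.Icc a b
    · rw [h1 p (not_le.1 fun hd => hp ⟨hd, hq.2⟩), sub_self, zero_mul]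
    · rw [h p hq, mul_zero]

/-- An additive property of test functions which holds on `(u₁, u₂)`, and which is inherited from
translates to the left as long as these stay to the right of some `c < u₂`, holds on `(u₁, ∞)`: a
test function is a sum of pieces narrow enough to be translated into `(c, u₂)`. -/
theorem TestFn.property_of_translate {P : TestFn → Prop} {u₁ c u₂ : ℝ} (h₁ : u₁ < c) (h₂ : c < u₂)
    (hadd : ∀ f g, P f → P g → P (f + g))
    (hbase : ∀ f : TestFn, ∀ a b, u₁ < a → b < u₂ → TestFn.VanishesOff f a b → P f)
    (htrans : ∀ f : TestFn, ∀ a b t, 0 ≤ t → c < a - t → TestFn.VanishesOff f a b →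
      P (TestFn.translate t f) → P f)
    (f : TestFn) (a b : ℝ) (ha : u₁ < a) (hf : TestFn.VanishesOff f a b) : P f := by
  -- Extending the right end by `δ` leaves a piece of length less than `3 * δ`, which fits into
  -- `(c, u₂)`.
  set δ := (u₂ - c) / 4 with hδ
  have hδ0 : 0 < δ := by rw [hδ]; linarith
  have key : ∀ n : ℕ, ∀ f : TestFn, ∀ a b, u₁ < a → b < u₂ + n * δ → TestFn.VanishesOff f a b → P f := by
    intro n
    induction n with
    | zero =>
      intro f a b ha hb hf
      exact hbase f a b ha (by simpa using hb) hf
    | succ n ih =>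
      intro f a b ha hb hf
      push_cast at hb
      obtain ⟨f₁, f₂, rfl, hf₁, hf₂⟩ := hf.exists_add
        (c := u₂ + n * δ - 2 * δ) (d := u₂ + n * δ - δ) (by linarith)
      have hn : 0 ≤ (n : ℝ) * δ := by positivity
      refine hadd _ _ (ih f₁ _ _ ha (by linarith) hf₁) ?_
      refine htrans f₂ _ _ (n * δ + δ) (by linarith) (by linarith) hf₂ ?_
      exact hbase _ _ _ (by linarith) (by linarith) (hf₂.translate _)
  obtain ⟨n, hn⟩ := exists_nat_gt ((b - u₂) / δ)
  rw [div_lt_iff₀ hδ0] at hn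
  exact key n f a b ha (by linarith) hf

/-- There is a function of retarded time supported in `(v, w)` with integral one. -/
theorem TimeFn.exists_primitive_eq_one {v w : ℝ} (h : v < w) :
    ∃ g : TimeFn, tsupport g.toFun ⊆ Set.Ioo v w ∧ ∀ u, w ≤ u → g.primitive u = 1 := by
  let β : ContDiffBump ((v + w) / 2) :=
    ⟨(w - v) / 8, (w - v) / 4, by linarith, by linarith⟩
  have hsupp : tsupport (β.normed MeasureTheory.volume) ⊆ Set.Ioo v w := by
    rw [β.tsupport_normed_eq, Real.closedBall_eq_Icc]
    refine Set.Icc_subset_Ioo ?_ ?_ <;> dsimp only [β] <;> linarith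
  refine ⟨⟨β.normed MeasureTheory.volume, β.contDiff_normed, β.hasCompactSupport_normed⟩, hsupp,
    fun u hu => ?_⟩
  rw [← β.integral_normed (μ := MeasureTheory.volume), TimeFn.primitive]
  refine MeasureTheory.setIntegral_eq_integral_of_forall_compl_eq_zero fun t ht => ?_
  by_contra hn
  exact ht ((hsupp (subset_tsupport _ hn)).2.le.trans hu)

theorem TimeFn.supportedIn_toTestFn {g : TimeFn} {v w : ℝ}
    (hg : tsupport g.toFun ⊆ Set.Ioo v w) : TestFn.SupportedIn g.toTestFn (Set.Ioo v w) := by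
  refine (closure_mono ?_).trans hg
  rintro _ ⟨p, hp, rfl⟩
  exact hp

end TestFunctions

/-! ### Differentiating distributions along translations -/

section Translation

open Filter Topology

theorem iteratedFDeriv_fderiv_apply {E F : Type*} [NormedAddCommGroup E] [NormedSpace ℝ E]
    [NormedAddCommGroup F] [NormedSpace ℝ F] {f : E → F} (hf : ContDiff ℝ ∞ f) (v : E) (k : ℕ) :
    iteratedFDeriv ℝ k (fun p => fderiv ℝ f p v) = fun p => fderiv ℝ (iteratedFDeriv ℝ k f) p v := by
  induction k with
  | zero =>
    funext p
    ext m
    have h0 : iteratedFDeriv ℝ 0 f = (continuousMultilinearCurryFin0 ℝ E F).symm ∘ f :=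
      iteratedFDeriv_zero_eq_comp
    rw [h0, LinearIsometryEquiv.comp_fderiv']
    simp
  | succ k ih =>
    set F' := iteratedFDeriv ℝ k f with hF'
    have hF : ContDiff ℝ ∞ F' := hf.iteratedFDeriv_right (m := ∞) (by norm_cast)
    have hd : Differentiable ℝ (fderiv ℝ F') :=
      (hF.fderiv_right (m := 1) (by norm_cast)).differentiable one_ne_zero
    funext p
    rw [iteratedFDeriv_succ_eq_comp_left, iteratedFDeriv_succ_eq_comp_left, ih]
    let I : (E →L[ℝ] ContinuousMultilinearMap ℝ (fun _ : Fin k => E) F) ≃L[ℝ]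
        ContinuousMultilinearMap ℝ (fun _ : Fin (k + 1) => E) F :=
      (continuousMultilinearCurryLeftEquiv ℝ
        (fun _ : Fin (k + 1) => E) F).symm.toContinuousLinearEquiv
    have hcurry : fderiv ℝ (I ∘ fderiv ℝ F') p v = I (fderiv ℝ (fderiv ℝ F') p v) := by
      have := ContinuousLinearEquiv.comp_fderiv (𝕜 := ℝ)
        (E := E →L[ℝ] ContinuousMultilinearMap ℝ (fun _ : Fin k => E) F)
        (F := ContinuousMultilinearMap ℝ (fun _ : Fin (k + 1) => E) F) I (f := fderiv ℝ F') (x := p)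
      exact congrArg (fun T => T v) this
    refine Eq.trans (congrArg I ?_) hcurry.symm
    ext w : 1
    have hs : IsSymmSndFDerivAt ℝ F' p :=
      hF.contDiffAt.isSymmSndFDerivAt (by
        rw [minSmoothness_of_isRCLikeNormedField]
        exact WithTop.coe_le_coe.2 (le_top : (2 : ℕ∞) ≤ ⊤))
    rw [fderiv_clm_apply (hd p) (differentiableAt_const v)]
    simpa using hs w v

/-- First order Taylor expansion of `f` along null infinity, with all derivatives up to order `N`
and uniformly on `ℝ × S²`. -/
theorem TestFn.eventually_norm_iteratedFDeriv_le (f : TestFn) (N : ℕ) {ε : ℝ} (hε : 0 < ε) :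
    ∀ᶠ h in 𝓝 (0 : ℝ), ∀ k ≤ N, ∀ (u : ℝ) (x : E3), ‖x‖ = 1 →
      ‖iteratedFDeriv ℝ k (TestFn.translate h f - f - h • TestFn.du f).1 (u, x)‖ ≤ ε * |h| := by
  have key : ∀ k : ℕ, ∀ᶠ h in 𝓝 (0 : ℝ), ∀ (u : ℝ) (x : E3), ‖x‖ = 1 →
      ‖iteratedFDeriv ℝ k (TestFn.translate h f - f - h • TestFn.du f).1 (u, x)‖ ≤ ε * |h| := by
    intro k
    obtain ⟨hf, R, hR⟩ := f.2
    set e : ℝ × E3 := (1, 0) with he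
    set F := iteratedFDeriv ℝ k f.1 with hF
    have hFs : ContDiff ℝ ∞ F := hf.iteratedFDeriv_right (m := ∞) (by norm_cast)
    set G := fun p => fderiv ℝ F p e with hG
    have hGs : ContDiff ℝ ∞ G := (hFs.fderiv_right (m := ∞) (by simp)).clm_apply contDiff_const
    have hGdu : iteratedFDeriv ℝ k (TestFn.du f).1 = G := iteratedFDeriv_fderiv_apply hf e k
    have hG0 : ∀ p : ℝ × E3, R < |p.1| → G p = 0 := by
      intro p hp
      rw [← hGdu]
      exact TestFn.iteratedFDeriv_eq_zero (isOpen_lt_abs_fst R)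
        (fun _ hq => TestFn.dir_eq_zero (isOpen_lt_abs_fst R) hR e hq) k hp
    -- Uniform continuity of `G` along the first variable.
    obtain ⟨δ, hδ, huc⟩ : ∃ δ > 0, ∀ (u h : ℝ) (x : E3), ‖x‖ = 1 → |h| < δ →
        ‖G (u + h, x) - G (u, x)‖ ≤ ε := by
      have hcpt : IsCompact (Set.Icc (-(R + 2)) (R + 2) ×ˢ Metric.sphere (0 : E3) 1) :=
        isCompact_Icc.prod (isCompact_sphere 0 1)
      obtain ⟨δ, hδ, h⟩ := Metric.uniformContinuousOn_iff.1
        (hcpt.uniformContinuousOn_of_continuous hGs.continuous.continuousOn) ε hε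
      refine ⟨min δ 1, lt_min hδ one_pos, fun u t x hx ht => ?_⟩
      have ht1 := lt_of_lt_of_le ht (min_le_right _ _)
      have h3 := abs_sub_abs_le_abs_sub u (-t)
      have h4 := abs_add_le u t
      rw [abs_neg, sub_neg_eq_add] at h3
      by_cases hu : |u| ≤ R + 1
      · rw [← dist_eq_norm]
        refine (h _ ⟨abs_le.1 (by linarith), by simpa using hx⟩ _
          ⟨abs_le.1 (by linarith), by simpa using hx⟩ ?_).le
        rw [Prod.dist_eq, dist_self, Real.dist_eq, add_sub_cancel_left]
        exact max_lt (lt_of_lt_of_le ht (min_le_left _ _)) hδ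
      · rw [hG0 (u + t, x) (by simp only; linarith), hG0 (u, x) (by simp only; linarith)]
        simpa using hε.le
    filter_upwards [Metric.ball_mem_nhds 0 hδ] with h hh u x hx
    have hexp : iteratedFDeriv ℝ k (TestFn.translate h f - f - h • TestFn.du f).1 (u, x) =
        F (u + h, x) - F (u, x) - h • G (u, x) := by
      have e1 : (TestFn.translate h f - f - h • TestFn.du f).1 =
          (fun p => f.1 (p + (h, 0))) - f.1 - h • (TestFn.du f).1 := rfl
      have c1 : ContDiff ℝ k (fun p : ℝ × E3 => f.1 (p + (h, 0))) :=
        (TestFn.translate h f).2.1.of_le (by exact_mod_cast le_top)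
      have c2 : ContDiff ℝ k f.1 := hf.of_le (by exact_mod_cast le_top)
      have c3 : ContDiff ℝ k (TestFn.du f).1 :=
        (TestFn.du f).2.1.of_le (by exact_mod_cast le_top)
      have c4 : ContDiff ℝ k ((fun p : ℝ × E3 => f.1 (p + (h, 0))) - f.1) := c1.sub c2
      have c5 : ContDiff ℝ k (h • (TestFn.du f).1) := c3.const_smul h
      rw [e1, iteratedFDeriv_sub_apply c4.contDiffAt c5.contDiffAt,
        iteratedFDeriv_sub_apply c1.contDiffAt c2.contDiffAt,
        iteratedFDeriv_const_smul_apply c3.contDiffAt, hGdu, iteratedFDeriv_comp_add_right]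
      simp [hF]
    rw [hexp]
    have hder : ∀ t : ℝ, HasDerivAt (fun t : ℝ => F (u + t, x) - t • G (u, x))
        (G (u + t, x) - G (u, x)) t := by
      intro t
      have h1 : HasDerivAt (fun t : ℝ => ((u + t, x) : ℝ × E3)) e t :=
        ((hasDerivAt_id t).const_add u).prodMk (hasDerivAt_const t x)
      have h2 := ((hFs.differentiable (by simp)) (u + t, x)).hasFDerivAt.comp_hasDerivAt t h1
      have h3 := (hasDerivAt_id t).smul_const (G (u, x))
      simpa [hG] using h2.fun_sub h3
    have hmv := (convex_ball (0 : ℝ) δ).norm_image_sub_le_of_norm_hasDerivWithin_le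
      (fun t _ => (hder t).hasDerivWithinAt)
      (fun t ht => huc u t x hx (by simpa using ht)) (Metric.mem_ball_self hδ) hh
    simpa [sub_right_comm] using hmv
  exact ((Set.finite_Iic N).eventually_all (l := 𝓝 (0 : ℝ))).2 fun k _ => key k

variable {V : Type*} [NormedAddCommGroup V] [NormedSpace ℝ V]

/-- The family `v s` of vector-valued distributions is bounded, in finitely many derivatives over
`ℝ × S²`, locally uniformly in `s`. -/
def LocallyBounded (v : ℝ → TestFn →ₗ[ℝ] V) : Prop :=
  ∀ R S : ℝ, ∃ (C : ℝ) (N : ℕ), ∀ f : TestFn,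
    (∀ p : ℝ × E3, R < |p.1| → f.1 p = 0) → ∀ s : ℝ, |s| ≤ S → ∀ B : ℝ,
      (∀ k ≤ N, ∀ (u : ℝ) (x : E3), ‖x‖ = 1 → ‖iteratedFDeriv ℝ k f.1 (u, x)‖ ≤ B) →
        ‖v s f‖ ≤ C * B

/-- A pointwise differentiable and locally bounded family of distributions may be differentiated
along a translation of the test function. -/
theorem LocallyBounded.hasDerivAt_translate {v : ℝ → TestFn →ₗ[ℝ] V} (hv : LocallyBounded v)
    {w : ℝ → TestFn → V} (hw : ∀ f s, HasDerivAt (fun s => v s f) (w s f) s) (c : ℝ) (f : TestFn)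
    (s : ℝ) : HasDerivAt (fun s => v s (TestFn.translate (c * s) f))
      (w s (TestFn.translate (c * s) f) + c • v s (TestFn.du (TestFn.translate (c * s) f))) s := by
  set F := TestFn.translate (c * s) f with hF
  -- The Taylor remainder of the test function.
  set r : ℝ → TestFn := fun t => TestFn.translate (c * (t - s)) F - F -
    (c * (t - s)) • TestFn.du F with hr
  have hsplit : (fun t => v t (TestFn.translate (c * t) f)) =
      fun t => v t F + (c * (t - s)) • v t (TestFn.du F) + v t (r t) := by
    funext t
    have : TestFn.translate (c * t) f = F + (c * (t - s)) • TestFn.du F + r t := by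
      have h1 : TestFn.translate (c * (t - s)) F = TestFn.translate (c * t) f := by
        rw [hF, TestFn.translate_translate]
        ring_nf
      simp only [hr, h1]
      abel
    rw [this, map_add, map_add, map_smul]
  have h1 := hw F s
  have h2 : HasDerivAt (fun t => (c * (t - s)) • v t (TestFn.du F)) (c • v s (TestFn.du F)) s := by
    have := (((hasDerivAt_id s).sub_const s).const_mul c).fun_smul (hw (TestFn.du F) s)
    simpa using this
  have h3 : HasDerivAt (fun t => v t (r t)) 0 s := by
    have hrs : v s (r s) = 0 := by
      have : r s = 0 := by
        simp only [hr, sub_self, mul_zero, zero_smul, TestFn.translate_zero]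
      rw [this, map_zero]
    rw [hasDerivAt_iff_isLittleO, Asymptotics.isLittleO_iff]
    intro ε hε
    obtain ⟨R, hR⟩ := F.2.2
    obtain ⟨C, N, hC⟩ := hv (R + 1) (|s| + 1)
    set η := ε / (|C| * |c| + 1) with hη
    have hη0 : 0 < η := by positivity
    have htend : Tendsto (fun t => c * (t - s)) (𝓝 s) (𝓝 0) := by
      have : Continuous fun t => c * (t - s) := by fun_prop
      simpa using this.tendsto s
    have hsmall : ∀ᶠ t in 𝓝 s, |c * (t - s)| < 1 := by
      have := htend.abs
      rw [abs_zero] at this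
      exact this.eventually_lt_const one_pos
    filter_upwards [htend.eventually (TestFn.eventually_norm_iteratedFDeriv_le F N hη0), hsmall,
      Metric.ball_mem_nhds s one_pos] with t ht hct hts
    rw [hrs, sub_zero, smul_zero, sub_zero]
    have hts' : |t| ≤ |s| + 1 := by
      have h5 := abs_sub_abs_le_abs_sub t s
      rw [Metric.mem_ball, Real.dist_eq] at hts
      linarith
    have hsupp : ∀ p : ℝ × E3, R + 1 < |p.1| → (r t).1 p = 0 := by
      intro p hp
      have hF0 := hR p (by linarith)
      have hdu : (TestFn.du F).1 p = 0 :=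
        TestFn.dir_eq_zero (isOpen_lt_abs_fst R) hR _ (show R < |p.1| by linarith)
      have htr : (TestFn.translate (c * (t - s)) F).1 p = 0 := by
        refine hR _ ?_
        have := abs_sub_abs_le_abs_sub p.1 (-(c * (t - s)))
        rw [abs_neg, sub_neg_eq_add] at this
        simp only [Prod.fst_add]
        linarith
      change (TestFn.translate (c * (t - s)) F).1 p - F.1 p -
        (c * (t - s)) * (TestFn.du F).1 p = 0
      rw [hF0, hdu, htr]
      ring
    refine (hC (r t) hsupp t hts' _ ht).trans ?_
    have hle : C * η ≤ |C| * η := mul_le_mul_of_nonneg_right (le_abs_self C) hη0.le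
    have hη1 : |C| * |c| * η ≤ ε := by
      rw [hη, mul_div_assoc', div_le_iff₀ (by positivity)]
      nlinarith [abs_nonneg C, abs_nonneg c]
    rw [abs_mul, Real.norm_eq_abs]
    calc C * (η * (|c| * |t - s|)) = C * η * (|c| * |t - s|) := by ring
      _ ≤ |C| * η * (|c| * |t - s|) := mul_le_mul_of_nonneg_right hle (by positivity)
      _ = |C| * |c| * η * |t - s| := by ring
      _ ≤ ε * |t - s| := mul_le_mul_of_nonneg_right hη1 (abs_nonneg _)
  rw [hsplit]
  simpa using (h1.fun_add h2).fun_add h3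

end Translation

/-! ### From weak to strong differentiability -/

section Weak

open Filter Topology

variable {K : Type*} [NormedAddCommGroup K] [InnerProductSpace ℂ K] {D : Submodule ℂ K}

theorem norm_le_of_dense_inner (hD : Dense (D : Set K)) {v : K} {C : ℝ} (hC : 0 ≤ C)
    (h : ∀ η : D, ‖⟪(η : K), v⟫_ℂ‖ ≤ C * ‖(η : K)‖) : ‖v‖ ≤ C := by
  have hc : IsClosed {η : K | ‖⟪η, v⟫_ℂ‖ ≤ C * ‖η‖} :=
    isClosed_le (by fun_prop) (by fun_prop)
  have hv : ‖⟪v, v⟫_ℂ‖ ≤ C * ‖v‖ :=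
    hc.closure_subset_iff.2 (fun η hη => h ⟨η, hη⟩) (hD v)
  rcases eq_or_ne v 0 with rfl | hne
  · rwa [norm_zero]
  · rw [inner_self_eq_norm_sq_to_K, norm_pow, RCLike.norm_ofReal, abs_norm, sq] at hv
    exact le_of_mul_le_mul_right hv (norm_pos_iff.2 hne)

theorem norm_sub_le_of_weak_hasDerivAt (hD : Dense (D : Set K)) {v w : ℝ → K}
    (h : ∀ (η : D) s, HasDerivAt (fun s => ⟪(η : K), v s⟫_ℂ) ⟪(η : K), w s⟫_ℂ s) {I : Set ℝ}
    (hI : Convex ℝ I) {C : ℝ} (hC : 0 ≤ C) (hw : ∀ s ∈ I, ‖w s‖ ≤ C) {s t : ℝ} (hs : s ∈ I)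
    (ht : t ∈ I) : ‖v t - v s‖ ≤ C * |t - s| := by
  refine norm_le_of_dense_inner hD (by positivity) fun η => ?_
  rw [inner_sub_right]
  have := hI.norm_image_sub_le_of_norm_hasDerivWithin_le (C := C * ‖(η : K)‖)
    (fun r _ => (h η r).hasDerivWithinAt) (fun r hr => (norm_inner_le_norm _ _).trans ?_) hs ht
  · rw [Real.norm_eq_abs] at this
    linarith
  · rw [mul_comm]
    exact mul_le_mul_of_nonneg_right (hw r hr) (norm_nonneg _)

/-- A weak derivative, tested on a dense subspace, is a strong derivative if it is continuous. -/
theorem hasDerivAt_of_weak (hD : Dense (D : Set K)) {v w : ℝ → K}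
    (h : ∀ (η : D) s, HasDerivAt (fun s => ⟪(η : K), v s⟫_ℂ) ⟪(η : K), w s⟫_ℂ s)
    (hw : Continuous w) (s : ℝ) : HasDerivAt v (w s) s := by
  have h' : ∀ (η : D) r, HasDerivAt (fun r => ⟪(η : K), v r - (r - s) • w s⟫_ℂ)
      ⟪(η : K), w r - w s⟫_ℂ r := by
    intro η r
    have h1 : HasDerivAt (fun r : ℝ => (r - s) • ⟪(η : K), w s⟫_ℂ) ⟪(η : K), w s⟫_ℂ r := by
      simpa using ((hasDerivAt_id r).sub_const s).smul_const ⟪(η : K), w s⟫_ℂ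
    have h2 := (h η r).fun_sub h1
    rw [inner_sub_right]
    refine h2.congr_of_eventuallyEq (Eventually.of_forall fun r => ?_)
    simp only [inner_sub_right, inner_smul_right_eq_smul]
  rw [hasDerivAt_iff_isLittleO, Asymptotics.isLittleO_iff]
  intro ε hε
  obtain ⟨δ, hδ, hball⟩ := Metric.continuousAt_iff.1 hw.continuousAt ε hε
  filter_upwards [Metric.ball_mem_nhds s hδ] with t ht
  have := norm_sub_le_of_weak_hasDerivAt hD h' (convex_ball s δ) hε.le
    (fun r hr => by rw [← dist_eq_norm]; exact (hball hr).le) (Metric.mem_ball_self hδ) ht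
  simpa [sub_right_comm] using this

end Weak

/-! ### Unitary orbits -/

section Flow

variable {K : Type*} [NormedAddCommGroup K] [InnerProductSpace ℂ K] {D : Submodule ℂ K}
  {A : D →ₗ[ℂ] D} {U : ℝ → (K ≃ₗᵢ[ℂ] K)}

/-- The orbit `s ↦ U s ψ` of a vector in the domain. -/
def IsUnitaryFlow.orbit (hU : IsUnitaryFlow A U) (ψ : D) (s : ℝ) : D := ⟨U s ψ, hU.preserves s ψ⟩

theorem IsUnitaryFlow.zero_apply (hU : IsUnitaryFlow A U) (ψ : K) : U 0 ψ = ψ :=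
  (U 0).injective (by rw [← hU.add, add_zero])

theorem IsUnitaryFlow.orbit_zero (hU : IsUnitaryFlow A U) (ψ : D) : hU.orbit ψ 0 = ψ :=
  Subtype.ext (hU.zero_apply ψ)

theorem IsUnitaryFlow.hasDerivAt_orbit (hU : IsUnitaryFlow A U) (ψ : D) (s : ℝ) :
    HasDerivAt (fun s => (hU.orbit ψ s : K)) (Complex.I • (A (hU.orbit ψ s) : K)) s := by
  have h1 := hU.generator (hU.orbit ψ s)
  have h2 : HasDerivAt (fun t : ℝ => t - s) 1 s := (hasDerivAt_id s).sub_const s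
  have h3 := h1.scomp_of_eq s h2 (sub_self s).symm
  rw [one_smul] at h3
  refine h3.congr_of_eventuallyEq (Filter.Eventually.of_forall fun t => ?_)
  change U t ψ = U (t - s) (U s ψ)
  rw [← hU.add, sub_add_cancel]

/-- The generator commutes with its unitary group. -/
theorem IsUnitaryFlow.generator_orbit (hU : IsUnitaryFlow A U) (ψ : D) (s : ℝ) :
    A (hU.orbit ψ s) = hU.orbit (A ψ) s := by
  have h1 := hU.generator ψ
  have h2 : HasDerivAt (fun t : ℝ => t - s) 1 s := (hasDerivAt_id s).sub_const s
  have h3 := h1.scomp_of_eq s h2 (sub_self s).symm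
  rw [one_smul] at h3
  have h4 := ((U s).toContinuousLinearEquiv.toContinuousLinearMap.restrictScalars
    ℝ).hasFDerivAt.comp_hasDerivAt s h3
  have h5 : HasDerivAt (fun s => (hU.orbit ψ s : K)) (U s (Complex.I • (A ψ : K))) s := by
    refine h4.congr_of_eventuallyEq (Filter.Eventually.of_forall fun t => ?_)
    change U t ψ = U s (U (t - s) ψ)
    rw [← hU.add, add_sub_cancel]
  have h6 := (hU.hasDerivAt_orbit ψ s).unique h5
  rw [map_smul] at h6
  exact Subtype.ext (smul_right_injective K Complex.I_ne_zero h6)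

end Flow

/-! ### Fields along orbits of the Bondi mass -/

namespace AsymptoticFields

variable {K : Type*} [NormedAddCommGroup K] [InnerProductSpace ℂ K] {ι : Type*}

/-- The vector-valued distributions `f ↦ Φ(f) ψ(s)` for a curve `ψ` in the domain. -/
def fieldAlong (T : AsymptoticFields K ι) (a : FieldIndex ι) (ψ : ℝ → T.domain) (s : ℝ) :
    TestFn →ₗ[ℝ] K where
  toFun f := (T.field a f (ψ s) : K)
  map_add' f g := by rw [map_add, LinearMap.add_apply, Submodule.coe_add]
  map_smul' r f := by
    rw [T.field_smul, LinearMap.smul_apply, Submodule.coe_smul, Complex.coe_smul]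
    rfl

variable (T : AsymptoticFields K ι)

theorem locallyBounded_const (a : FieldIndex ι) (ψ : T.domain) :
    LocallyBounded (T.fieldAlong a fun _ => ψ) := by
  intro R S
  -- Any of the bounds along orbits will do, taken at the start of the orbit.
  obtain ⟨U, hU, h⟩ := T.regular ⟨fun _ => 0, contDiff_const, .zero⟩
  obtain ⟨C, N, hC⟩ := h a ψ R 0
  refine ⟨C, N, fun f hf s _ B hB => ?_⟩
  have := hC f hf 0 (by simp) B hB
  rwa [show (⟨U 0 ψ, hU.preserves 0 ψ⟩ : T.domain) = ψ from hU.orbit_zero ψ] at this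

/-- Derivative of a smeared field along an orbit of the Bondi mass. -/
theorem hasDerivAt_field_orbit {g : TimeFn} {U : ℝ → (K ≃ₗᵢ[ℂ] K)}
    (hU : IsUnitaryFlow (T.bondiMass g) U) {a : FieldIndex ι}
    (hb : ∀ ψ, LocallyBounded (T.fieldAlong a (hU.orbit ψ))) (f : TestFn) (ψ : T.domain) (s : ℝ) :
    HasDerivAt (fun s => (T.field a f (hU.orbit ψ s) : K))
      (Complex.I • (T.field a f (hU.orbit (T.bondiMass g ψ) s) : K)) s := by
  have hsymm := (T.field_selfAdjoint a f).1
  have hweak : ∀ (ψ η : T.domain) s,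
      HasDerivAt (fun s => ⟪(η : K), (T.field a f (hU.orbit ψ s) : K)⟫_ℂ)
        ⟪(η : K), Complex.I • (T.field a f (hU.orbit (T.bondiMass g ψ) s) : K)⟫_ℂ s := by
    intro ψ η s
    have h1 := (hasDerivAt_const s (T.field a f η : K)).inner ℂ (hU.hasDerivAt_orbit ψ s)
    rw [inner_zero_left, add_zero, hU.generator_orbit, inner_smul_right, hsymm,
      ← inner_smul_right] at h1
    refine h1.congr_of_eventuallyEq (Filter.Eventually.of_forall fun t => ?_)
    exact (hsymm _ _).symm
  have hbound : ∀ (ψ : T.domain) (S : ℝ), ∃ C, 0 ≤ C ∧ ∀ s, |s| ≤ S →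
      ‖(T.field a f (hU.orbit ψ s) : K)‖ ≤ C := by
    intro ψ S
    obtain ⟨R, hR⟩ := f.2.2
    obtain ⟨C, N, hC⟩ := hb ψ R S
    obtain ⟨B, hB⟩ := TestFn.exists_norm_iteratedFDeriv_le f N
    exact ⟨max (C * B) 0, le_max_right _ _, fun s hs =>
      (hC f hR s hs B hB).trans (le_max_left _ _)⟩
  have hcont : ∀ ψ : T.domain, Continuous fun s => (T.field a f (hU.orbit ψ s) : K) := by
    intro ψ
    rw [continuous_iff_continuousAt]
    intro s
    obtain ⟨C, hC0, hC⟩ := hbound (T.bondiMass g ψ) (|s| + 1)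
    have hsmem : s ∈ Set.Ioo (-(|s| + 1)) (|s| + 1) := abs_lt.1 (by linarith)
    have hlip : LipschitzOnWith C.toNNReal (fun s => (T.field a f (hU.orbit ψ s) : K))
        (Set.Ioo (-(|s| + 1)) (|s| + 1)) := by
      refine LipschitzOnWith.of_dist_le_mul fun x hx y hy => ?_
      rw [dist_eq_norm, Real.dist_eq, Real.coe_toNNReal _ hC0]
      refine norm_sub_le_of_weak_hasDerivAt T.dense (hweak ψ) (convex_Ioo _ _) hC0
        (fun r hr => ?_) hy hx
      rw [norm_smul, Complex.norm_I, one_mul]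
      exact hC r (abs_lt.2 hr).le
    exact hlip.continuousOn.continuousAt (isOpen_Ioo.mem_nhds hsmem)
  exact hasDerivAt_of_weak T.dense (hweak ψ) ((hcont _).const_smul Complex.I) s

/-- Derivative of the commutator form along curves. -/
theorem hasDerivAt_commForm (X : K →L[ℂ] K) {φ ψ y z : ℝ → K} {φ' ψ' y' z' : K} {s : ℝ}
    (hφ : HasDerivAt φ φ' s) (hψ : HasDerivAt ψ ψ' s) (hy : HasDerivAt y y' s)
    (hz : HasDerivAt z z' s) :
    HasDerivAt (fun s => ⟪φ s, X (y s)⟫_ℂ - ⟪z s, X (ψ s)⟫_ℂ)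
      (⟪φ s, X y'⟫_ℂ + ⟪φ', X (y s)⟫_ℂ - (⟪z s, X ψ'⟫_ℂ + ⟪z', X (ψ s)⟫_ℂ)) s := by
  have hX : ∀ {v : ℝ → K} {v' : K}, HasDerivAt v v' s → HasDerivAt (fun s => X (v s)) (X v') s :=
    fun h => (X.restrictScalars ℝ).hasFDerivAt.comp_hasDerivAt s h
  exact (hφ.inner ℂ (hX hy)).fun_sub (hz.inner ℂ (hX hψ))

/-! ### Fields commuting with the commutant of a segment -/

variable [CompleteSpace K] {T} {G : ℝ}

theorem field_commutesWithClosure {u₁ u₂ : ℝ} {X : K →L[ℂ] K}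
    (hX : X ∈ (T.segmentAlgebra u₁ u₂).commutant) (a : FieldIndex ι) {f : TestFn}
    (hf : TestFn.SupportedIn f (Set.Ioo u₁ u₂)) : CommutesWithClosure X (T.field a f) :=
  (mem_commutant_generatedAlgebra.1 hX _ ⟨a, f, hf, rfl⟩).1

/-- The commutator law of the Bondi mass, as an identity of forms on the domain: for `X` in the
commutant of the segment containing the support of `g`, the local operators drop out. -/
theorem BondiMassLaws.commForm_identity (hT : T.BondiMassLaws G) {u₁ u₂ : ℝ} {X : K →L[ℂ] K}
    (hX : X ∈ (T.segmentAlgebra u₁ u₂).commutant) {a : FieldIndex ι} (ha : a ≠ .bondiMass)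
    {g : TimeFn} (hg : tsupport g.toFun ⊆ Set.Ioo u₁ u₂) (f : TestFn) (φ ψ : T.domain) :
    ⟪(φ : K), X (Complex.I • (T.field a f (T.bondiMass g ψ) : K))⟫_ℂ
      + ⟪Complex.I • (T.bondiMass g φ : K), X (T.field a f ψ)⟫_ℂ
      - (⟪(T.field a f φ : K), X (Complex.I • (T.bondiMass g ψ : K))⟫_ℂ
        + ⟪Complex.I • (T.field a f (T.bondiMass g φ) : K), X ψ⟫_ℂ)
      = (4 * Real.pi * G : ℝ) *
        commForm X (T.field a (TestFn.du (TestFn.mulPrimitive g f))) φ ψ := by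
  have hM : ∀ φ ψ : T.domain,
      ⟪(φ : K), X (T.bondiMass g ψ)⟫_ℂ = ⟪(T.bondiMass g φ : K), X ψ⟫_ℂ := fun φ ψ =>
    sub_eq_zero.1 <| (field_commutesWithClosure hX .bondiMass
      (TimeFn.supportedIn_toTestFn hg)).commForm_eq_zero (T.field_selfAdjoint _ _).1 φ ψ
  set Φ := T.field a f with hΦ
  set Φ' := T.field a (TestFn.du (TestFn.mulPrimitive g f)) with hΦ'
  set M := T.bondiMass g with hMdef
  set c : ℝ := 4 * Real.pi * G with hc
  have hΦs : IsSymmetricOn Φ := (T.field_selfAdjoint _ _).1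
  have hΦs' : IsSymmetricOn Φ' := (T.field_selfAdjoint _ _).1
  have hMs : IsSymmetricOn M := (T.field_selfAdjoint _ _).1
  set L := M ∘ₗ Φ - Φ ∘ₗ M - ((c : ℝ) * Complex.I : ℂ) • Φ' with hL
  -- The local term is antisymmetric.
  have hLs : ∀ φ ψ : T.domain, ⟪((-L) φ : K), (ψ : K)⟫_ℂ = ⟪(φ : K), (L ψ : K)⟫_ℂ := by
    intro φ ψ
    simp only [hL, LinearMap.neg_apply, LinearMap.sub_apply, LinearMap.smul_apply,
      LinearMap.comp_apply, Submodule.coe_neg, Submodule.coe_sub, Submodule.coe_smul,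
      inner_neg_left, inner_sub_left, inner_sub_right, inner_smul_left, inner_smul_right,
      hMs _ _, hΦs _ _, hΦs' _ _, map_mul, Complex.conj_I, Complex.conj_ofReal]
    ring
  have hLX : ⟪((-L) φ : K), X ψ⟫_ℂ = ⟪(φ : K), X (L ψ)⟫_ℂ :=
    inner_eq_of_mem_closedGraph hLs (hT.commutator a ha g f u₁ u₂ hg X hX ψ) φ
  simp only [hL, LinearMap.neg_apply, LinearMap.sub_apply, LinearMap.smul_apply,
    LinearMap.comp_apply, Submodule.coe_neg, Submodule.coe_sub, Submodule.coe_smul,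
    inner_neg_left, inner_sub_left, inner_sub_right, inner_smul_left, inner_smul_right, map_sub,
    map_smul, map_mul, Complex.conj_I, Complex.conj_ofReal, hM] at hLX
  simp only [commForm, map_smul, inner_smul_left, inner_smul_right, Complex.conj_I, hM]
  linear_combination Complex.I * hLX +
    (c * ⟪(Φ' φ : K), X ψ⟫_ℂ - c * ⟪(φ : K), X (Φ' ψ)⟫_ℂ) * (Complex.I_mul_I)

/-- The flow of the Bondi mass `∫ g(u) M(u) du`, which translates fields to the right of the
support of `g`, carries commutation from a translated radiative field back to the field itself. -/
theorem BondiMassLaws.commForm_eq_zero_of_translate (hT : T.BondiMassLaws G) (hG : 0 < G)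
    {u₁ c u₂ : ℝ} {X : K →L[ℂ] K} (hX : X ∈ (T.segmentAlgebra u₁ u₂).commutant) (h₁ : u₁ < c)
    (h₂ : c < u₂) {a : FieldIndex ι} (ha : a ≠ .bondiMass) {f : TestFn} {p q t : ℝ}
    (ht : 0 ≤ t) (hp : c < p - t) (hf : TestFn.VanishesOff f p q)
    (h0 : ∀ φ ψ, commForm X (T.field a (TestFn.translate t f)) φ ψ = 0) (φ ψ : T.domain) :
    commForm X (T.field a f) φ ψ = 0 := by
  obtain ⟨g, hg, hg1⟩ := TimeFn.exists_primitive_eq_one h₁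
  obtain ⟨U, hU', hreg⟩ := T.regular g
  have hU : IsUnitaryFlow (T.bondiMass g) U := hU'
  have hb : ∀ ψ, LocallyBounded (T.fieldAlong a (hU.orbit ψ)) := fun ψ R S => hreg a ψ R S
  set κ : ℝ := 4 * Real.pi * G with hκ
  have hκ0 : 0 < κ := by positivity
  set F : ℝ → TestFn := fun s => TestFn.translate (-κ * s) f with hF
  set Q : ℝ → ℂ := fun s => commForm X (T.field a (F s)) (hU.orbit φ s) (hU.orbit ψ s) with hQ
  have hfield : ∀ (ψ : T.domain) (s : ℝ),
      HasDerivAt (fun s => (T.field a (F s) (hU.orbit ψ s) : K))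
        (Complex.I • (T.field a (F s) (T.bondiMass g (hU.orbit ψ s)) : K)
          + (-κ) • (T.field a (TestFn.du (F s)) (hU.orbit ψ s) : K)) s := by
    intro ψ s
    have := (hb ψ).hasDerivAt_translate
      (fun f s => T.hasDerivAt_field_orbit hU hb f ψ s) (-κ) f s
    rw [← hU.generator_orbit] at this
    exact this
  -- For `s` between `-(t / κ)` and `0` the test function `F s` stays to the right of `c`, where the
  -- primitive of `g` is one, so that the commutator law cancels the derivative of `F`.
  have hder : ∀ s ∈ Set.Ico (-(t / κ)) 0, HasDerivAt Q 0 s := by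
    intro s hs
    have h := hasDerivAt_commForm X (hU.hasDerivAt_orbit φ s) (hU.hasDerivAt_orbit ψ s)
      (hfield ψ s) (hfield φ s)
    have hid := hT.commForm_identity hX ha
      (hg.trans (Set.Ioo_subset_Ioo_right h₂.le)) (F s) (hU.orbit φ s) (hU.orbit ψ s)
    have hst : -κ * s ≤ t := by
      have := hs.1
      rw [neg_le, le_div_iff₀ hκ0] at this
      linarith
    have hmul : TestFn.mulPrimitive g (F s) = F s :=
      (hf.translate (-κ * s)).mulPrimitive_eq fun u hu => hg1 u (by linarith)
    have e1 : ∀ v x y : K, ⟪v, X (x + (-κ) • y)⟫_ℂ = ⟪v, X x⟫_ℂ - κ * ⟪v, X y⟫_ℂ := by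
      intro v x y
      rw [map_add, inner_add_right, ← Complex.coe_smul, map_smul, inner_smul_right]
      push_cast
      ring
    have e2 : ∀ v x y : K, ⟪x + (-κ) • y, v⟫_ℂ = ⟪x, v⟫_ℂ - κ * ⟪y, v⟫_ℂ := by
      intro v x y
      rw [inner_add_left, ← Complex.coe_smul, inner_smul_left, Complex.conj_ofReal]
      push_cast
      ring
    rw [hmul, commForm, ← hκ] at hid
    rw [e1, e2] at h
    refine h.congr_deriv ?_
    linear_combination hid
  have hcont : ContinuousOn Q (Set.Icc (-(t / κ)) 0) := by
    have : Continuous Q := continuous_iff_continuousAt.2 fun s =>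
      (hasDerivAt_commForm X (hU.hasDerivAt_orbit φ s) (hU.hasDerivAt_orbit ψ s)
        (hfield ψ s) (hfield φ s)).continuousAt
    exact this.continuousOn
  have hle : -(t / κ) ≤ 0 := by
    rw [neg_nonpos]
    positivity
  have hconst := constant_of_has_deriv_right_zero hcont
    (fun s hs => (hder s hs).hasDerivWithinAt) 0 (Set.right_mem_Icc.2 hle)
  have hFt : F (-(t / κ)) = TestFn.translate t f := by
    simp only [hF]
    congr 1
    field_simp
  have hF0 : F 0 = f := by
    simp only [hF, mul_zero, TestFn.translate_zero]
  simp only [hQ, hFt, hF0, hU.orbit_zero, h0] at hconst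
  exact hconst

/-- The commutant of a segment commutes with all radiative fields to the right of its left end. -/
theorem BondiMassLaws.commForm_radiative (hT : T.BondiMassLaws G) (hG : 0 < G) {u₁ u₂ : ℝ}
    (h : u₁ < u₂) {X : K →L[ℂ] K} (hX : X ∈ (T.segmentAlgebra u₁ u₂).commutant)
    {a : FieldIndex ι} (ha : a ≠ .bondiMass) {f : TestFn} {p q : ℝ} (hp : u₁ < p)
    (hf : TestFn.VanishesOff f p q) (φ ψ : T.domain) : commForm X (T.field a f) φ ψ = 0 := by
  refine TestFn.property_of_translate
    (P := fun f => ∀ φ ψ, commForm X (T.field a f) φ ψ = 0) (c := (u₁ + u₂) / 2) (u₂ := u₂)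
    (by linarith) (by linarith) ?_ ?_ ?_ f p q hp hf φ ψ
  · intro f g hf hg φ ψ
    rw [map_add, commForm_add, hf, hg, add_zero]
  · intro f p q hp hq hf φ ψ
    exact (field_commutesWithClosure hX a (hf.supportedIn hp hq)).commForm_eq_zero
      (T.field_selfAdjoint a f).1 φ ψ
  · intro f p q t ht hpt hf h0 φ ψ
    exact hT.commForm_eq_zero_of_translate hG hX (by linarith) (by linarith) ha ht hpt hf h0 φ ψ

theorem BondiMassLaws.mem_commutant_radiativeAlgebra (hT : T.BondiMassLaws G) (hG : 0 < G)
    {u₁ u₂ : ℝ} (h : u₁ < u₂) {X : K →L[ℂ] K} (hX : X ∈ (T.segmentAlgebra u₁ u₂).commutant)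
    {w : ℝ} (hw : u₁ < w) : X ∈ (T.radiativeAlgebra u₁ w).commutant := by
  refine mem_commutant_generatedAlgebra.2 ?_
  rintro _ ⟨a, f, ha, hf, rfl⟩
  obtain ⟨p, q, hp, -, hpq⟩ := hf.exists_vanishesOff hw
  exact ⟨commutesWithClosure_of_commForm (T.field_selfAdjoint a f)
      (hT.commForm_radiative hG h hX ha hp hpq),
    commutesWithClosure_of_commForm (T.field_selfAdjoint a f)
      (hT.commForm_radiative hG h (star_mem hX) ha hp hpq)⟩

/-- The commutant of a segment commutes with `∂_u m_B` to the right of its left end: by the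
evolution law this is a local operator of the radiative fields. -/
theorem BondiMassLaws.commForm_bondiMass_du (hT : T.BondiMassLaws G) (hG : 0 < G) {u₁ u₂ : ℝ}
    (h : u₁ < u₂) {X : K →L[ℂ] K} (hX : X ∈ (T.segmentAlgebra u₁ u₂).commutant) {f : TestFn}
    {p q : ℝ} (hp : u₁ < p) (hf : TestFn.VanishesOff f p q) (φ ψ : T.domain) :
    commForm X (T.field .bondiMass (TestFn.du f)) φ ψ = 0 := by
  set w := max u₁ q + 1 with hw
  have hw1 : u₁ < w := by linarith [le_max_left u₁ q]
  have hw2 : q < w := by linarith [le_max_right u₁ q]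
  set m := T.field .bondiMass (TestFn.du f) with hm
  set Y := T.divDivShear (TestFn.du f) with hY
  have hdd : ∀ φ ψ, commForm X Y φ ψ = 0 := by
    intro φ ψ
    have hterm : ∀ i j, commForm X (T.field (.shear i j)
        (TestFn.dx i (TestFn.dx j (TestFn.du f)))) φ ψ = 0 := fun i j =>
      hT.commForm_radiative hG h hX (by simp) hp (((hf.dir _).dir _).dir _) φ ψ
    simp only [hY, divDivShear, Fin.sum_univ_three, commForm_add, hterm, add_zero]
  have hYs : IsSymmetricOn Y := by
    intro φ ψ
    have hterm : ∀ i j, ⟪(T.field (.shear i j)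
        (TestFn.dx i (TestFn.dx j (TestFn.du f))) φ : K), (ψ : K)⟫_ℂ = ⟪(φ : K), (T.field
          (.shear i j) (TestFn.dx i (TestFn.dx j (TestFn.du f))) ψ : K)⟫_ℂ := fun i j =>
      (T.field_selfAdjoint _ _).1 φ ψ
    simp only [hY, divDivShear, Fin.sum_univ_three, LinearMap.add_apply, Submodule.coe_add,
      inner_add_left, inner_add_right, hterm]
  have hms : IsSymmetricOn m := (T.field_selfAdjoint _ _).1
  have h4 : (starRingEnd ℂ) (1 / 4 : ℂ) = 1 / 4 := by rw [map_div₀, map_one, map_ofNat]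
  have hflux : IsSymmetricOn (m - (1 / 4 : ℂ) • Y) := by
    intro φ ψ
    simp only [LinearMap.sub_apply, LinearMap.smul_apply, Submodule.coe_sub, Submodule.coe_smul,
      inner_sub_left, inner_sub_right, inner_smul_left, inner_smul_right, hms φ ψ, hYs φ ψ, h4]
  have h1 := CommutesWithClosure.commForm_eq_zero (hT.evolution f u₁ w (hf.supportedIn hp hw2) X
    (hT.mem_commutant_radiativeAlgebra hG h hX hw1)) hflux φ ψ
  have h2 := hdd φ ψ
  simp only [commForm, LinearMap.sub_apply, LinearMap.smul_apply, Submodule.coe_sub,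
    Submodule.coe_smul, map_sub, map_smul, inner_sub_left, inner_sub_right, inner_smul_left,
    inner_smul_right] at h1 h2 ⊢
  rw [h4] at h1
  linear_combination h1 + (1 / 4 : ℂ) * h2

theorem BondiMassLaws.commForm_bondiMass_of_translate (hT : T.BondiMassLaws G) (hG : 0 < G)
    {u₁ u₂ : ℝ} (h : u₁ < u₂) {X : K →L[ℂ] K} (hX : X ∈ (T.segmentAlgebra u₁ u₂).commutant)
    {f : TestFn} {p q t : ℝ} (ht : 0 ≤ t) (hp : u₁ < p - t) (hf : TestFn.VanishesOff f p q)
    (φ ψ : T.domain) (h0 : commForm X (T.field .bondiMass (TestFn.translate t f)) φ ψ = 0) :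
    commForm X (T.field .bondiMass f) φ ψ = 0 := by
  set Q : ℝ → ℂ := fun s => commForm X (T.field .bondiMass (TestFn.translate s f)) φ ψ with hQ
  have hfield : ∀ (ψ : T.domain) (s : ℝ),
      HasDerivAt (fun s => (T.field .bondiMass (TestFn.translate s f) ψ : K))
        (T.field .bondiMass (TestFn.du (TestFn.translate s f)) ψ : K) s := by
    intro ψ s
    have := (T.locallyBounded_const .bondiMass ψ).hasDerivAt_translate
      (w := fun f _ => 0) (fun f s => hasDerivAt_const s (T.field .bondiMass f ψ : K)) 1 f s
    simp only [one_mul, one_smul, zero_add] at this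
    exact this
  have hder := fun s => hasDerivAt_commForm X (hasDerivAt_const s (φ : K))
    (hasDerivAt_const s (ψ : K)) (hfield ψ s) (hfield φ s)
  have hder0 : ∀ s ∈ Set.Ico 0 t, HasDerivAt Q 0 s := by
    intro s hs
    have h1 := hT.commForm_bondiMass_du hG h hX (p := p - s) (by linarith [hs.2])
      (hf.translate s) φ ψ
    refine (hder s).congr_deriv ?_
    simp only [map_zero, inner_zero_left, inner_zero_right, add_zero, zero_add]
    exact h1
  have hcont : Continuous Q := continuous_iff_continuousAt.2 fun s => (hder s).continuousAt
  have hconst := constant_of_has_deriv_right_zero hcont.continuousOn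
    (fun s hs => (hder0 s hs).hasDerivWithinAt) t (Set.right_mem_Icc.2 ht)
  simp only [hQ, TestFn.translate_zero, h0] at hconst
  exact hconst.symm

/-- The commutant of a segment commutes with the Bondi mass aspect to the right of its left end. -/
theorem BondiMassLaws.commForm_bondiMass (hT : T.BondiMassLaws G) (hG : 0 < G) {u₁ u₂ : ℝ}
    (h : u₁ < u₂) {X : K →L[ℂ] K} (hX : X ∈ (T.segmentAlgebra u₁ u₂).commutant) {f : TestFn}
    {p q : ℝ} (hp : u₁ < p) (hf : TestFn.VanishesOff f p q) (φ ψ : T.domain) :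
    commForm X (T.field .bondiMass f) φ ψ = 0 := by
  refine TestFn.property_of_translate
    (P := fun f => commForm X (T.field .bondiMass f) φ ψ = 0) (c := (u₁ + u₂) / 2) (u₂ := u₂)
    (by linarith) (by linarith) ?_ ?_ ?_ f p q hp hf
  · intro f g hf hg
    rw [map_add, commForm_add, hf, hg, add_zero]
  · intro f p q hp hq hf
    exact (field_commutesWithClosure hX .bondiMass (hf.supportedIn hp hq)).commForm_eq_zero
      (T.field_selfAdjoint _ f).1 φ ψ
  · intro f p q t ht hpt hf h0
    exact hT.commForm_bondiMass_of_translate hG h hX ht (by linarith) hf φ ψ h0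

theorem BondiMassLaws.commutant_le (hT : T.BondiMassLaws G) (hG : 0 < G) {u₁ u₂ u₂' : ℝ}
    (h : u₁ < u₂) (h' : u₁ < u₂') {X : K →L[ℂ] K}
    (hX : X ∈ (T.segmentAlgebra u₁ u₂).commutant) : X ∈ (T.segmentAlgebra u₁ u₂').commutant := by
  have main : ∀ X ∈ (T.segmentAlgebra u₁ u₂).commutant, ∀ a f,
      TestFn.SupportedIn f (Set.Ioo u₁ u₂') → CommutesWithClosure X (T.field a f) := by
    intro X hX a f hf
    obtain ⟨p, q, hp, -, hpq⟩ := hf.exists_vanishesOff h'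
    refine commutesWithClosure_of_commForm (T.field_selfAdjoint a f) fun φ ψ => ?_
    by_cases ha : a = .bondiMass
    · subst ha
      exact hT.commForm_bondiMass hG h hX hp hpq φ ψ
    · exact hT.commForm_radiative hG h hX ha hp hpq φ ψ
  refine mem_commutant_generatedAlgebra.2 ?_
  rintro _ ⟨a, f, hf, rfl⟩
  exact ⟨main X hX a f hf, main _ (star_mem hX) a f hf⟩

/-- The algebra of a segment does not depend on its right end. -/
theorem BondiMassLaws.segmentAlgebra_eq (hT : T.BondiMassLaws G) (hG : 0 < G) {u₁ u₂ u₂' : ℝ}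
    (h : u₁ < u₂) (h' : u₁ < u₂') : T.segmentAlgebra u₁ u₂ = T.segmentAlgebra u₁ u₂' := by
  rw [← VonNeumannAlgebra.commutant_commutant (T.segmentAlgebra u₁ u₂),
    ← VonNeumannAlgebra.commutant_commutant (T.segmentAlgebra u₁ u₂')]
  congr 1
  exact SetLike.ext fun X => ⟨hT.commutant_le hG h h', hT.commutant_le hG h' h⟩

end AsymptoticFields

end NullInfinity

end

theorem mainTheorem5 {K : Type*} [NormedAddCommGroup K] [InnerProductSpace ℂ K] [CompleteSpace K]
    {ι : Type*} (T : NullInfinity.AsymptoticFields K ι) (G : ℝ) (hG : 0 < G)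
    (hT : T.BondiMassLaws G) (u₁ u₂ u₂' : ℝ) (h₂ : u₁ < u₂) (h₂' : u₁ < u₂') :
    (∀ ε : ℝ, 0 < ε → T.segmentAlgebra u₁ u₂ ≤ T.cutAlgebra u₁ ε) ∧
    ∀ τ : (K →L[ℂ] K) → ENNReal,
      (τ = NullInfinity.hilbertTrace K ∨
        NullInfinity.IsFaithfulNormalTrace (T.segmentAlgebra u₁ u₂) τ) →
      ∀ μ : K →L[ℂ] K, NullInfinity.IsDensityMatrix μ →
        (∀ ρ : K →L[ℂ] K,
          NullInfinity.IsReducedDensityMatrix τ (T.segmentAlgebra u₁ u₂) μ ρ ↔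
            NullInfinity.IsReducedDensityMatrix τ (T.segmentAlgebra u₁ u₂') μ ρ) ∧
        ∀ ρ ρ' : K →L[ℂ] K,
          NullInfinity.IsReducedDensityMatrix τ (T.segmentAlgebra u₁ u₂) μ ρ →
          NullInfinity.IsReducedDensityMatrix τ (T.segmentAlgebra u₁ u₂') μ ρ' →
            NullInfinity.vonNeumannEntropy τ ρ = NullInfinity.vonNeumannEntropy τ ρ' := by
  have heq : ∀ {w : ℝ}, u₁ < w → T.segmentAlgebra u₁ u₂ = T.segmentAlgebra u₁ w := fun hw =>
    hT.segmentAlgebra_eq hG h₂ hw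
  refine ⟨fun ε hε => (heq (lt_add_of_pos_right u₁ hε)).le, fun τ hτ μ hμ => ?_⟩
  have hτ' : NullInfinity.IsFaithfulTraceOn (T.segmentAlgebra u₁ u₂) τ := by
    rcases hτ with rfl | hτ
    · exact NullInfinity.isFaithfulTraceOn_hilbertTrace _
    · exact hτ.isFaithfulTraceOn
  rw [← heq h₂']
  exact ⟨fun ρ => Iff.rfl, fun ρ ρ' hρ hρ' => by rw [hρ.unique hτ' hμ hρ']⟩
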